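/- Consider two layer ReLU networks $f_{V,U}(x)=V[Ux]_+$ with $x\in\mathbb R^d$, $U\in\mathbb R^{h\times d}$, $V\in\mathbb R^{c\times h}$, where $[\cdot]_+$ is the entrywise positive part. For scores $s\in\mathbb R^c$ and a label $y\in\{1,\dots,c\}$ let $\mu(s,y)=s_y-\max_{i\ne y}s_i$ be the margin. For $\gamma>0$ let $\ell_\gamma(s,y)$ be $0$ if $\mu(s,y)>\gamma$, $1-\mu(s,y)/\gamma$ if $0\le\mu(s,y)\le\gamma$, and $1$ if $\mu(s,y)<0$. For a probability distribution $\mathcal D$ on $\mathbb R^d\times\{1,\dots,c\}$ let $L_0(f)=\mathbb P_{(x,y)\sim\mathcal D}[\mu(f(x),y)\le 0]$ be the classification error, and for a training set $S=((x_i,y_i))_{i=1}^m$ let $\hat L_\gamma(f)=\frac1m\sum_{i=1}^m\ell_\gamma(f(x_i),y_i)$. For $p>0$ let $\|A\|_{p,2}=\big(\sum_j\|a_j\|_2^p\big)^{1/p}$, where $a_j$ are the rows of $A$; let $\|\cdot\|_F$ be the Frobenius norm and $\|\cdot\|_2$ the Euclidean norm of a vector or the spectral norm of a matrix. There are absolute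 constants $C>0$ and $k\in\mathbb N$ such that the following holds for all integers $d\ge 0$, $c\ge2$, $h\ge 2$, $m\ge1$, all $\gamma>0$, $\delta\in(0,1)$, every probability distribution $\mathcal D$ on $\mathbb R^d\times\{1,\dots,c\}$ and every $U^0\in\mathbb R^{h\times d}$. With probability at least $1-\delta$ over a training set $S$ of $m$ independent samples from $\mathcal D$, with $X\in\mathbb R^{d\times m}$ the matrix whose columns are $x_1,\dots,x_m$, one has, simultaneously for all $V\in\mathbb R^{c\times h}$ and $U\in\mathbb R^{h\times d}$, with $f=f_{V,U}$ and $\Lambda=C\big(\ln\frac{hm}{\delta}\big)^k$, $$L_0(f)\le\hat L_\gamma(f)+\Lambda\,\frac{\sqrt c\,h^{\frac12-\frac1{\ln h}}\|V^T\|_{\ln h,2}\Big(h^{\frac12-\frac1{\ln h}}\|U-U^0\|_{\ln h,2}\|X\|_F+\|U^0X\|_F\Big)}{\gamma m}$$ $$\le\hat L_\gamma(f)+\Lambda\,\frac{\sqrt c\,h^{\frac12-\frac1{\ln h}}\|V^T\|_{\ln h,2}\Big(h^{\frac12-\frac1{\ln h}}\|U-U^0\|_{\ln h,2}+\|U^0\|_2\Big)\sqrt{\frac1m\sum_{i=1}^m\|x_i\|_2^2}}{\gamma\sqrt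 m}.$$ -/

import Mathlib

open MeasureTheory

noncomputable section

/-- The two layer ReLU network `x ↦ V [U x]₊` with input dimension `d`, `h` hidden units and
`c` outputs. -/
def reluNet {d h c : ℕ} (V : Matrix (Fin c) (Fin h) ℝ) (U : Matrix (Fin h) (Fin d) ℝ)
    (x : Fin d → ℝ) : Fin c → ℝ :=
  V.mulVec (fun j => max (U.mulVec x j) 0)

/-- Margin of the score vector `s` at the label `y`: the score of `y` minus the largest score
among the other labels (meaningful for at least two labels). -/
def margin {c : ℕ} (s : Fin c → ℝ) (y : Fin c) : ℝ :=
  s y - ⨆ i : {i : Fin c // i ≠ y}, s i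

/-- The ramp loss as a function of the margin `t`: `0` above `γ`, `1` below `0`, and linearly
decreasing in between. -/
def ramp (γ t : ℝ) : ℝ :=
  if γ < t then 0 else if t < 0 then 1 else 1 - t / γ

/-- At `γ = 0` the ramp loss is the classification loss, ties being counted as errors. -/
theorem ramp_zero (t : ℝ) : ramp 0 t = if t ≤ 0 then 1 else 0 := by
  unfold ramp
  by_cases h : 0 < t
  · simp [h, not_le.mpr h]
  · simp [h, not_lt.mp h]

/-- Expected margin loss of the predictor `f` under the distribution `D`. -/
def expectedLoss {d c : ℕ} (D : Measure ((Fin d → ℝ) × Fin c)) (γ : ℝ)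
    (f : (Fin d → ℝ) → Fin c → ℝ) : ℝ :=
  ∫ z, ramp γ (margin (f z.1) z.2) ∂D

/-- Empirical margin loss of the predictor `f` on the training set `S`. -/
def empiricalLoss {d c m : ℕ} (S : Fin m → (Fin d → ℝ) × Fin c) (γ : ℝ)
    (f : (Fin d → ℝ) → Fin c → ℝ) : ℝ :=
  (∑ i, ramp γ (margin (f (S i).1) (S i).2)) / m

/-- The Euclidean norm of a vector. -/
def euclNorm {n : ℕ} (v : Fin n → ℝ) : ℝ :=
  ‖WithLp.toLp 2 v‖

/-- The Frobenius norm of a matrix. -/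
def frobNorm {a b : ℕ} (A : Matrix (Fin a) (Fin b) ℝ) : ℝ :=
  Real.sqrt (∑ i, ∑ j, A i j ^ 2)

/-- The spectral norm of a matrix: its operator norm between Euclidean spaces. -/
def specNorm {a b : ℕ} (A : Matrix (Fin a) (Fin b) ℝ) : ℝ :=
  ‖LinearMap.toContinuousLinearMap (Matrix.toLpLin 2 2 A)‖

/-- `‖A‖_{p,2}`: the `ℓ_p` norm of the vector of Euclidean norms of the rows of `A`. -/
def rowNorm {a b : ℕ} (p : ℝ) (A : Matrix (Fin a) (Fin b) ℝ) : ℝ :=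
  (∑ i, euclNorm (A i) ^ p) ^ (1 / p)

/-- The data matrix of a training set; its columns are the inputs. -/
def dataMatrix {d c m : ℕ} (S : Fin m → (Fin d → ℝ) × Fin c) : Matrix (Fin d) (Fin m) ℝ :=
  Matrix.of fun k i => (S i).1 k

end

/-! Every row of a matrix is bounded by its `rowNorm`, and h^(1/2 - 1/ln h) = √h / e. Up to the
factor e² it therefore suffices to work with a bound α on the columns of V and a bound β on the rows
of U - U⁰. These enter through the size W = √c √h α (√h β P + Q) / γ (`netSize`), where P and Q are
the Frobenius norms of X and U⁰X. With `clip` equal to one minus the ramp loss, the goal becomes: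
uniformly over networks, the sum of the clipped margins over the sample exceeds m (1 - L₀) by at
most a logarithm times W.

At a fixed scale this follows from an exponential moment bound. Symmetrization
(`lintegral_exp_maxVal_sum_le`) passes to random signs, and bounded differences in the signs
(`signAvg_exp_maxVal_le`) reduce the matter to the mean of the maximum. Contraction
(`signAvg_maxVal_contract`) replaces the loss by the coordinates of the output, and then each neuron
by linear forms in its output and input weights. Signed sums of linear forms are controlled by the
Hilbert space geometry (`signAvg_maxVal_inner_le`). Adding up the h neurons gives
`signAvg_reluNet_le`. Dense sequences extend the bound from finite classes to all weights.

Two issues remain: the inputs are unbounded, and P, Q, α, β are not fixed in advance. Inputs are set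
to zero beyond a level exceeded with probability about log(1/ε)/m, where ε is the failure
probability of one event. Few sample points are affected, each costing at most one, and with high
probability the truncated population scales s₁, s₂ are at most 2P/√m and 2Q/√m. A zero input has
clipped margin zero, so truncation only lowers the expectation. Positive homogeneity of the ReLU
moves the whole scale of the hidden layer into V (`exists_scaled_weights`), leaving one scale to
discretize, with at most 2m values. For W ≥ m the claim is trivial. For W < 1/2, enlarging V to size
1/2 keeps margins at most γ, where `clip` is homogeneous, and does not change the classification
error. The second inequality is Q ≤ ‖U⁰‖₂ P. -/

/-! ### Sign averages of the maximum of a finite process -/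

/-- The average of `Φ (a ± x₁ ± ⋯ ± xₙ)` over all choices of signs. -/
noncomputable def signAvg {F : Type*} (Φ : (F → ℝ) → ℝ) : (F → ℝ) → List (F → ℝ) → ℝ
  | a, [] => Φ a
  | a, x :: xs => (signAvg Φ (a + x) xs + signAvg Φ (a - x) xs) / 2

/-- The largest value of a function on a finite type. -/
noncomputable def maxVal {F : Type*} [Fintype F] [Nonempty F] (a : F → ℝ) : ℝ :=
  Finset.univ.sup' Finset.univ_nonempty a

section MaxVal

variable {F : Type*} [Fintype F] [Nonempty F]

theorem le_maxVal (a : F → ℝ) (f : F) : a f ≤ maxVal a :=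
  Finset.le_sup' a (Finset.mem_univ f)

theorem maxVal_le {a : F → ℝ} {B : ℝ} (h : ∀ f, a f ≤ B) : maxVal a ≤ B :=
  Finset.sup'_le _ _ fun f _ => h f

theorem exists_maxVal_eq (a : F → ℝ) : ∃ f, maxVal a = a f := by
  obtain ⟨f, -, hf⟩ := Finset.exists_mem_eq_sup' (Finset.univ_nonempty (α := F)) a
  exact ⟨f, hf⟩

theorem maxVal_add_le (a b : F → ℝ) : maxVal (a + b) ≤ maxVal a + maxVal b :=
  maxVal_le fun f => add_le_add (le_maxVal a f) (le_maxVal b f)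

theorem maxVal_zero : maxVal (0 : F → ℝ) = 0 := by
  obtain ⟨f, hf⟩ := exists_maxVal_eq (0 : F → ℝ)
  simpa using hf

theorem maxVal_midpoint (a y : F → ℝ) :
    maxVal a ≤ (maxVal (a + y) + maxVal (a - y)) / 2 := by
  refine maxVal_le fun f => ?_
  have h1 := le_maxVal (a + y) f
  have h2 := le_maxVal (a - y) f
  simp only [Pi.add_apply, Pi.sub_apply] at h1 h2
  linarith

theorem maxVal_le_add_norm (a b : F → ℝ) : maxVal a ≤ maxVal b + ‖a - b‖ := by
  refine maxVal_le fun f => ?_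
  have h1 := le_maxVal b f
  have h2 := (le_abs_self _).trans ((Real.norm_eq_abs _).symm.le.trans (norm_le_pi_norm (a - b) f))
  simp only [Pi.sub_apply] at h2
  linarith

end MaxVal

section SignAvg

variable {F : Type*}

theorem signAvg_append (Φ : (F → ℝ) → ℝ) (a : F → ℝ) (xs ys : List (F → ℝ)) :
    signAvg Φ a (xs ++ ys) = signAvg (fun b => signAvg Φ b ys) a xs := by
  induction xs generalizing a with
  | nil => rfl
  | cons x xs ih => simp only [List.cons_append, signAvg, ih]

theorem signAvg_average (Φ : (F → ℝ) → ℝ) (a y : F → ℝ) (xs : List (F → ℝ)) :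
    signAvg (fun b => (Φ (b + y) + Φ (b - y)) / 2) a xs
      = (signAvg Φ (a + y) xs + signAvg Φ (a - y) xs) / 2 := by
  induction xs generalizing a with
  | nil => rfl
  | cons x xs ih =>
    simp only [signAvg, ih]
    rw [add_right_comm a x y, add_sub_right_comm a x y, sub_add_eq_add_sub a x y,
      sub_right_comm a x y]
    ring

theorem le_signAvg {Φ : (F → ℝ) → ℝ} (hΦ : ∀ a y, Φ a ≤ (Φ (a + y) + Φ (a - y)) / 2)
    (a : F → ℝ) (xs : List (F → ℝ)) : Φ a ≤ signAvg Φ a xs := by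
  induction xs generalizing a with
  | nil => exact le_rfl
  | cons x xs ih =>
    simp only [signAvg]
    linarith [hΦ a x, ih (a + x), ih (a - x)]

/-- By midpoint convexity, averaging over any further sign only increases the value, so all signs
but one may be dropped. A contraction step can thus keep the one useful member of a list. -/
theorem average_le_signAvg {Φ : (F → ℝ) → ℝ} (hΦ : ∀ a y, Φ a ≤ (Φ (a + y) + Φ (a - y)) / 2)
    (a x : F → ℝ) (xs : List (F → ℝ)) (hx : x ∈ xs) :
    (Φ (a + x) + Φ (a - x)) / 2 ≤ signAvg Φ a xs := by
  induction xs generalizing a with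
  | nil => simp at hx
  | cons y xs ih =>
    simp only [signAvg]
    rcases List.mem_cons.1 hx with rfl | hx
    · linarith [le_signAvg hΦ (a + x) xs, le_signAvg hΦ (a - x) xs]
    · have h1 := ih (a + y) hx
      have h2 := ih (a - y) hx
      have h3 := hΦ (a + x) y
      have h4 := hΦ (a - x) y
      rw [add_right_comm a x y, add_sub_right_comm a x y] at h3
      rw [sub_add_eq_add_sub a x y, sub_right_comm a x y] at h4
      linarith

variable [Fintype F] [Nonempty F]

theorem signAvg_maxVal_le_add_norm (a b : F → ℝ) (xs : List (F → ℝ)) :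
    signAvg maxVal a xs ≤ signAvg maxVal b xs + ‖a - b‖ := by
  induction xs generalizing a b with
  | nil => exact maxVal_le_add_norm a b
  | cons x xs ih =>
    simp only [signAvg]
    have h1 := ih (a + x) (b + x)
    have h2 := ih (a - x) (b - x)
    rw [add_sub_add_right_eq_sub] at h1
    rw [sub_sub_sub_cancel_right] at h2
    linarith

theorem average_exp_le (u v : ℝ) :
    (Real.exp u + Real.exp v) / 2 ≤ Real.exp ((u + v) / 2 + ((u - v) / 2) ^ 2 / 2) := by
  have h : (Real.exp u + Real.exp v) / 2 = Real.exp ((u + v) / 2) * Real.cosh ((u - v) / 2) := by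
    rw [Real.cosh_eq, mul_div_assoc', mul_add, ← Real.exp_add, ← Real.exp_add]
    ring_nf
  rw [h, Real.exp_add]
  gcongr
  exact Real.cosh_le_exp_half_sq _

/-- Bounded differences inequality for the maximum of a sign process. -/
theorem signAvg_exp_maxVal_le (a : F → ℝ) (xs : List (F → ℝ)) :
    signAvg (fun b => Real.exp (maxVal b)) a xs
      ≤ Real.exp (signAvg maxVal a xs + (xs.map fun x => ‖x‖ ^ 2).sum / 2) := by
  induction xs generalizing a with
  | nil => simp [signAvg]
  | cons x xs ih =>
    simp only [signAvg, List.map_cons, List.sum_cons]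
    set T := (xs.map fun x => ‖x‖ ^ 2).sum
    set u := signAvg maxVal (a + x) xs with hu
    set v := signAvg maxVal (a - x) xs with hv
    have h1 := ih (a + x)
    have h2 := ih (a - x)
    have e1 := signAvg_maxVal_le_add_norm (a + x) (a - x) xs
    have e2 := signAvg_maxVal_le_add_norm (a - x) (a + x) xs
    rw [show a + x - (a - x) = (2 : ℝ) • x by rw [two_smul]; abel, norm_smul] at e1
    rw [show a - x - (a + x) = (-2 : ℝ) • x by rw [neg_smul, two_smul]; abel, norm_smul] at e2
    norm_num at e1 e2
    rw [← hu, ← hv] at e1 e2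
    -- Flipping one sign shifts the process by `2 • x`, hence moves the average of the maximum by at
    -- most `2 * ‖x‖`.
    have h3 : ((u - v) / 2) ^ 2 ≤ ‖x‖ ^ 2 := by
      apply sq_le_sq'
      · linarith
      · linarith
    calc _ ≤ (Real.exp (u + T / 2) + Real.exp (v + T / 2)) / 2 := by linarith
      _ ≤ _ := average_exp_le _ _
      _ ≤ _ := by
        apply Real.exp_le_exp.2
        have : u + T / 2 - (v + T / 2) = u - v := by ring
        rw [this]
        linarith

theorem signAvg_maxVal_add_le {ι : Type*} (I : List ι) (a b : F → ℝ) (x y : ι → F → ℝ) :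
    signAvg maxVal (a + b) (I.map fun i => x i + y i)
      ≤ signAvg maxVal a (I.map x) + signAvg maxVal b (I.map y) := by
  induction I generalizing a b with
  | nil => exact maxVal_add_le a b
  | cons i I ih =>
    simp only [signAvg, List.map_cons]
    have h1 := ih (a + x i) (b + y i)
    have h2 := ih (a - x i) (b - y i)
    rw [add_add_add_comm] at h1
    rw [← add_sub_add_comm] at h2
    linarith

theorem signAvg_maxVal_zero {ι : Type*} (I : List ι) :
    signAvg maxVal (0 : F → ℝ) (I.map fun _ => 0) = 0 := by
  induction I with
  | nil => exact maxVal_zero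
  | cons i I ih => simp only [List.map_cons, signAvg, add_zero, sub_zero, ih]; norm_num

theorem signAvg_maxVal_sum_le {ι κ : Type*} (I : List ι) (s : Finset κ) (x : κ → ι → F → ℝ) :
    signAvg maxVal 0 (I.map fun i => ∑ j ∈ s, x j i)
      ≤ ∑ j ∈ s, signAvg maxVal 0 (I.map (x j)) := by
  classical
  induction s using Finset.induction_on with
  | empty =>
    simp only [Finset.sum_empty]
    exact (signAvg_maxVal_zero I).le
  | insert j s hj ih =>
    simp only [Finset.sum_insert hj]
    have := signAvg_maxVal_add_le I 0 0 (x j) (fun i => ∑ j ∈ s, x j i)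
    rw [add_zero] at this
    linarith

/-- The two signs of `x` select maximizers `f` and `f'`, and their joint contribution involves only
the increment of `x` between them. A member `l` of `g` with a larger increment on this pair does at
least as well for one of the two ways of assigning its signs to the pair. Since `l` may depend on
the pair, a product or a vector-valued map can be replaced by a list of its factors or coordinates.
-/
theorem signAvg_maxVal_contract_cons (a x : F → ℝ) (g xs : List (F → ℝ))
    (h : ∀ f f', ∃ l ∈ g, |x f - x f'| ≤ |l f - l f'|) :
    signAvg maxVal a (x :: xs) ≤ signAvg maxVal a (g ++ xs) := by
  rw [signAvg_append]
  suffices H : ∀ a, (signAvg maxVal (a + x) xs + signAvg maxVal (a - x) xs) / 2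
      ≤ signAvg (fun b => signAvg maxVal b xs) a g from H a
  induction xs with
  | nil =>
    intro a
    simp only [signAvg]
    obtain ⟨f, hf⟩ := exists_maxVal_eq (a + x)
    obtain ⟨f', hf'⟩ := exists_maxVal_eq (a - x)
    obtain ⟨l, hl, hle⟩ := h f f'
    have h1 := average_le_signAvg (maxVal_midpoint (F := F)) a l g hl
    have h2 := le_maxVal (a + l) f
    have h3 := le_maxVal (a + l) f'
    have h4 := le_maxVal (a - l) f
    have h5 := le_maxVal (a - l) f'
    have h6 := le_abs_self (x f - x f')
    simp only [Pi.add_apply, Pi.sub_apply] at *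
    rcases abs_cases (l f - l f') with ⟨h7, -⟩ | ⟨h7, -⟩ <;> linarith
  | cons y ys ih =>
    intro a
    simp only [signAvg]
    rw [signAvg_average (fun b => signAvg maxVal b ys)]
    have h1 := ih (a + y)
    have h2 := ih (a - y)
    rw [add_right_comm a x y, add_sub_right_comm a x y, sub_add_eq_add_sub a x y,
      sub_right_comm a x y]
    linarith

/-- Contraction: replacing each term by a list of terms one of which has larger increments does
not decrease the average of the maximum. -/
theorem signAvg_maxVal_contract {ι : Type*} (I : List ι) (a : F → ℝ) (x : ι → F → ℝ)
    (g : ι → List (F → ℝ)) (h : ∀ i f f', ∃ l ∈ g i, |x i f - x i f'| ≤ |l f - l f'|) :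
    signAvg maxVal a (I.map x) ≤ signAvg maxVal a (I.flatMap g) := by
  induction I generalizing a with
  | nil => exact le_rfl
  | cons i I ih =>
    rw [List.flatMap_cons]
    refine le_trans ?_ (signAvg_maxVal_contract_cons a (x i) (g i) _ (h i))
    simp only [signAvg, List.map_cons]
    linarith [ih (a + x i), ih (a - x i)]

/-- The vector `y₀` collects the terms whose signs are already fixed. By the parallelogram law the
mean of `‖y₀ ± y i‖ ^ 2` is `‖y₀‖ ^ 2 + ‖y i‖ ^ 2`, and concavity of the square root carries this
through the induction. -/
theorem signAvg_maxVal_inner_le {E ι : Type*} [NormedAddCommGroup E] [InnerProductSpace ℝ E]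
    (I : List ι) (p : F → E) {M : ℝ} (hp : ∀ f, ‖p f‖ ≤ M) (y₀ : E) (y : ι → E) :
    signAvg maxVal (fun f => inner ℝ (p f) y₀) (I.map fun i f => inner ℝ (p f) (y i))
      ≤ M * Real.sqrt (‖y₀‖ ^ 2 + (I.map fun i => ‖y i‖ ^ 2).sum) := by
  have hM : 0 ≤ M := (norm_nonneg _).trans (hp (Classical.arbitrary F))
  induction I generalizing y₀ with
  | nil =>
    simp only [List.map_nil, signAvg, List.sum_nil, add_zero, Real.sqrt_sq (norm_nonneg _)]
    exact maxVal_le fun f => (real_inner_le_norm _ _).trans (by gcongr; exact hp f)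
  | cons i I ih =>
    simp only [List.map_cons, signAvg, List.sum_cons]
    set T := (I.map fun i => ‖y i‖ ^ 2).sum with hT
    have hT0 : 0 ≤ T := List.sum_nonneg (by simp)
    have h1 := ih (y₀ + y i)
    have h2 := ih (y₀ - y i)
    simp only [inner_add_right] at h1
    simp only [inner_sub_right] at h2
    have key : (Real.sqrt (‖y₀ + y i‖ ^ 2 + T) + Real.sqrt (‖y₀ - y i‖ ^ 2 + T)) / 2
        ≤ Real.sqrt (‖y₀‖ ^ 2 + (‖y i‖ ^ 2 + T)) := by
      apply Real.le_sqrt_of_sq_le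
      have p1 := Real.sq_sqrt (show 0 ≤ ‖y₀ + y i‖ ^ 2 + T by positivity)
      have p2 := Real.sq_sqrt (show 0 ≤ ‖y₀ - y i‖ ^ 2 + T by positivity)
      have p3 := parallelogram_law_with_norm ℝ y₀ (y i)
      nlinarith [sq_nonneg (Real.sqrt (‖y₀ + y i‖ ^ 2 + T) - Real.sqrt (‖y₀ - y i‖ ^ 2 + T))]
    calc _ ≤ M * ((Real.sqrt (‖y₀ + y i‖ ^ 2 + T) + Real.sqrt (‖y₀ - y i‖ ^ 2 + T)) / 2) := by
          have e1 : ((fun f => inner ℝ (p f) y₀) + fun f => inner ℝ (p f) (y i))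
            = fun f => inner ℝ (p f) y₀ + inner ℝ (p f) (y i) := rfl
          have e2 : ((fun f => inner ℝ (p f) y₀) - fun f => inner ℝ (p f) (y i))
            = fun f => inner ℝ (p f) y₀ - inner ℝ (p f) (y i) := rfl
          rw [e1, e2]
          linarith
      _ ≤ _ := by gcongr

end SignAvg

/-! ### Exponential moments and symmetrization for independent samples -/

section Independent

variable {Z : Type*} [MeasurableSpace Z] (D : Measure Z) [IsProbabilityMeasure D]

theorem piFinSuccAbove_symm_apply_cons {n : ℕ} (p : Z × (Fin n → Z)) :
    (MeasurableEquiv.piFinSuccAbove (fun _ : Fin (n + 1) => Z) 0).symm p = Fin.cons p.1 p.2 :=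
  Fin.insertNth_zero' p.1 p.2

theorem lintegral_pi_succ {n : ℕ} {G : (Fin (n + 1) → Z) → ENNReal} (hG : Measurable G) :
    ∫⁻ S, G S ∂Measure.pi (fun _ : Fin (n + 1) => D)
      = ∫⁻ z, ∫⁻ S, G (Fin.cons z S) ∂Measure.pi (fun _ : Fin n => D) ∂D := by
  have h := (measurePreserving_piFinSuccAbove (fun _ : Fin (n + 1) => D) 0).symm
  rw [← h.lintegral_comp hG, lintegral_prod]
  · simp only [piFinSuccAbove_symm_apply_cons]
  · exact (hG.comp h.measurable).aemeasurable

theorem lintegral_pi_prod (n : ℕ) {g : Z → ENNReal} (hg : Measurable g) :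
    ∫⁻ S, ∏ i, g (S i) ∂Measure.pi (fun _ : Fin n => D) = (∫⁻ z, g z ∂D) ^ n := by
  induction n with
  | zero => simp
  | succ n ih =>
    rw [lintegral_pi_succ D (by fun_prop)]
    simp only [Fin.prod_univ_succ, Fin.cons_zero, Fin.cons_succ]
    have : ∀ z, ∫⁻ S : Fin n → Z, g z * ∏ i, g (S i) ∂Measure.pi (fun _ : Fin n => D)
        = g z * (∫⁻ z, g z ∂D) ^ n := fun z => by
      rw [lintegral_const_mul _ (by fun_prop), ih]
    simp only [this]
    rw [lintegral_mul_const _ hg, pow_succ']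

theorem lintegral_exp_sum_le (n : ℕ) {Y : Z → ℝ} (hY : Measurable Y) {κ : ℝ}
    (h : ∫⁻ z, ENNReal.ofReal (Real.exp (Y z)) ∂D ≤ ENNReal.ofReal (Real.exp κ)) :
    ∫⁻ S, ENNReal.ofReal (Real.exp (∑ i, Y (S i))) ∂Measure.pi (fun _ : Fin n => D)
      ≤ ENNReal.ofReal (Real.exp (n * κ)) := by
  have e : ∀ S : Fin n → Z, ENNReal.ofReal (Real.exp (∑ i, Y (S i)))
      = ∏ i, ENNReal.ofReal (Real.exp (Y (S i))) := fun S => by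
    rw [Real.exp_sum, ENNReal.ofReal_prod_of_nonneg fun _ _ => (Real.exp_pos _).le]
  simp only [e]
  rw [lintegral_pi_prod D n (g := fun z => ENNReal.ofReal (Real.exp (Y z))) (by fun_prop),
    Real.exp_nat_mul, ENNReal.ofReal_pow (Real.exp_pos _).le]
  gcongr

theorem measure_gt_le_of_lintegral_exp_le {Ω : Type*} [MeasurableSpace Ω] (P : Measure Ω)
    {Y : Ω → ℝ} (hY : Measurable Y) {κ ε : ℝ} (hε : 0 < ε)
    (h : ∫⁻ ω, ENNReal.ofReal (Real.exp (Y ω)) ∂P ≤ ENNReal.ofReal (Real.exp κ)) :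
    P {ω | κ + Real.log (1 / ε) < Y ω} ≤ ENNReal.ofReal ε := by
  have hm := mul_meas_ge_le_lintegral (μ := P)
    (f := fun ω => ENNReal.ofReal (Real.exp (Y ω))) (by fun_prop)
    (ENNReal.ofReal (Real.exp (κ + Real.log (1 / ε))))
  have hsub : {ω | κ + Real.log (1 / ε) < Y ω} ⊆ {ω | ENNReal.ofReal (Real.exp
      (κ + Real.log (1 / ε))) ≤ ENNReal.ofReal (Real.exp (Y ω))} := fun ω hω =>
    ENNReal.ofReal_le_ofReal (Real.exp_le_exp.2 (le_of_lt hω))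
  have hpos : 0 < Real.exp (κ + Real.log (1 / ε)) := Real.exp_pos _
  have e : Real.exp κ = Real.exp (κ + Real.log (1 / ε)) * ε := by
    rw [Real.exp_add, Real.exp_log (by positivity)]; field_simp
  refine (measure_mono hsub).trans ?_
  have h2 := hm.trans h
  rw [e, ENNReal.ofReal_mul hpos.le] at h2
  exact (ENNReal.mul_le_mul_iff_right (by simpa using hpos) ENNReal.ofReal_ne_top).1 h2

/-- Exponential Markov inequality for sums of independent copies. -/
theorem measure_sum_gt_le (n : ℕ) {Y : Z → ℝ} (hY : Measurable Y) {κ ε : ℝ} (hε : 0 < ε)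
    (h : ∫⁻ z, ENNReal.ofReal (Real.exp (Y z)) ∂D ≤ ENNReal.ofReal (Real.exp κ)) :
    Measure.pi (fun _ : Fin n => D) {S | n * κ + Real.log (1 / ε) < ∑ i, Y (S i)}
      ≤ ENNReal.ofReal ε :=
  measure_gt_le_of_lintegral_exp_le _ (by fun_prop) hε (lintegral_exp_sum_le D n hY h)

/-- A linear majorant of the exponential suffices, because `1 + κ ≤ exp κ`. -/
theorem lintegral_exp_le_of_forall_le {Y W : Z → ℝ} (hW : Integrable W D) {κ : ℝ}
    (h : ∀ z, Real.exp (Y z) ≤ 1 + W z) (hκ : ∫ z, W z ∂D ≤ κ) :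
    ∫⁻ z, ENNReal.ofReal (Real.exp (Y z)) ∂D ≤ ENNReal.ofReal (Real.exp κ) := by
  calc _ ≤ ∫⁻ z, ENNReal.ofReal (1 + W z) ∂D :=
        lintegral_mono fun z => ENNReal.ofReal_le_ofReal (h z)
    _ = ENNReal.ofReal (∫ z, (1 + W z) ∂D) := by
        refine (ofReal_integral_eq_lintegral_ofReal ((integrable_const _).add hW) ?_).symm
        exact Filter.Eventually.of_forall fun z => (Real.exp_pos _).le.trans (h z)
    _ ≤ _ := by
        apply ENNReal.ofReal_le_ofReal
        rw [integral_add (integrable_const _) hW]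
        simp only [integral_const, probReal_univ, one_smul]
        linarith [Real.add_one_le_exp κ]

variable {F : Type*} [Fintype F] [Nonempty F]

theorem measurable_maxVal : Measurable (maxVal : (F → ℝ) → ℝ) := by
  have : (maxVal : (F → ℝ) → ℝ) = Finset.univ.sup' Finset.univ_nonempty fun f a => a f := by
    ext a; simp [maxVal, Finset.sup'_apply]
  rw [this]
  exact Finset.measurable_sup' _ fun f _ => measurable_pi_apply f

theorem Measurable.signAvg {Ω F : Type*} [MeasurableSpace Ω] {Φ : (F → ℝ) → ℝ}
    (hΦ : Measurable Φ) {a : Ω → F → ℝ} (ha : Measurable a) {xs : List (Ω → F → ℝ)}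
    (hxs : ∀ x ∈ xs, Measurable x) :
    Measurable fun ω => signAvg Φ (a ω) (xs.map fun x => x ω) := by
  induction xs generalizing a with
  | nil => exact hΦ.comp ha
  | cons x xs ih =>
    simp only [List.map_cons, _root_.signAvg]
    have hx := hxs x (by simp)
    have hxs' : ∀ x ∈ xs, Measurable x := fun y hy => hxs y (by simp [hy])
    exact ((ih (ha.add hx) hxs').add (ih (ha.sub hx) hxs')).div_const 2

/-- The vector `x - e` is the midpoint of `2 • x` and `-2 • e`, and the exponential of a maximum is
convex. Separating the two halves in this way makes a ghost sample unnecessary. -/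
theorem exp_maxVal_add_sub_le (a x e : F → ℝ) :
    Real.exp (maxVal (a + (x - e)))
      ≤ (Real.exp (maxVal (a + (2 : ℝ) • x)) + Real.exp (maxVal (a - (2 : ℝ) • e))) / 2 := by
  have h1 : maxVal (a + (x - e))
      ≤ (maxVal (a + (2 : ℝ) • x) + maxVal (a - (2 : ℝ) • e)) / 2 := by
    refine maxVal_le fun f => ?_
    have h1 := le_maxVal (a + (2 : ℝ) • x) f
    have h2 := le_maxVal (a - (2 : ℝ) • e) f
    simp only [Pi.add_apply, Pi.sub_apply, Pi.smul_apply, smul_eq_mul] at *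
    linarith
  refine (Real.exp_le_exp.2 h1).trans ?_
  have h2 := convexOn_exp.2 (Set.mem_univ (maxVal (a + (2 : ℝ) • x)))
    (Set.mem_univ (maxVal (a - (2 : ℝ) • e))) (by norm_num : (0 : ℝ) ≤ 1 / 2)
    (by norm_num : (0 : ℝ) ≤ 1 / 2) (by norm_num)
  simp only [smul_eq_mul] at h2
  convert h2 using 2 <;> ring

theorem ofReal_average {u v : ℝ} (hu : 0 ≤ u) (hv : 0 ≤ v) :
    ENNReal.ofReal ((u + v) / 2) = 2⁻¹ * (ENNReal.ofReal u + ENNReal.ofReal v) := by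
  rw [div_eq_inv_mul, ENNReal.ofReal_mul (by norm_num), ENNReal.ofReal_add hu hv,
    ENNReal.ofReal_inv_of_pos (by norm_num)]
  norm_num

/-- Jensen's inequality, at a coordinate where `a - 2 • e` is maximal, replaces the mean `e` by the
random vector. The two halves become the two signs of `2 • X z`, both evaluated at the same sample
point. -/
theorem lintegral_exp_maxVal_center_le {X : Z → F → ℝ} (hX : Measurable X) {B : ℝ}
    (hB : ∀ z f, |X z f| ≤ B) (a : F → ℝ) :
    ∫⁻ z, ENNReal.ofReal (Real.exp (maxVal (a + (X z - fun f => ∫ z, X z f ∂D)))) ∂D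
      ≤ 2⁻¹ * ∫⁻ z, (ENNReal.ofReal (Real.exp (maxVal (a + (2 : ℝ) • X z)))
        + ENNReal.ofReal (Real.exp (maxVal (a - (2 : ℝ) • X z)))) ∂D := by
  set e : F → ℝ := fun f => ∫ z, X z f ∂D with he
  have hmax : Measurable (maxVal : (F → ℝ) → ℝ) := measurable_maxVal
  have hXf : ∀ f, Measurable fun z => X z f := fun f => (measurable_pi_apply f).comp hX
  have hint : ∀ f, Integrable (fun z => X z f) D := fun f =>
    Integrable.of_bound (hXf f).aestronglyMeasurable B
      (Filter.Eventually.of_forall fun z => by simpa using hB z f)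
  have jensen : ENNReal.ofReal (Real.exp (maxVal (a - (2 : ℝ) • e)))
      ≤ ∫⁻ z, ENNReal.ofReal (Real.exp (maxVal (a - (2 : ℝ) • X z))) ∂D := by
    obtain ⟨f, hf⟩ := exists_maxVal_eq (a - (2 : ℝ) • e)
    have hi1 : Integrable (fun z => a f - 2 * X z f) D :=
      (integrable_const _).sub ((hint f).const_mul 2)
    have hi2 : Integrable (fun z => Real.exp (a f - 2 * X z f)) D := by
      refine Integrable.of_bound (by fun_prop) (Real.exp (a f + 2 * B))
        (Filter.Eventually.of_forall fun z => ?_)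
      rw [Real.norm_eq_abs, Real.abs_exp]
      apply Real.exp_le_exp.2
      linarith [neg_abs_le (X z f), hB z f]
    have hj := convexOn_exp.map_integral_le (μ := D) (f := fun z => a f - 2 * X z f)
      Real.continuous_exp.continuousOn isClosed_univ (by simp) hi1 hi2
    rw [integral_sub (integrable_const _) ((hint f).const_mul 2), integral_const_mul] at hj
    simp only [integral_const, probReal_univ, one_smul] at hj
    rw [hf]
    simp only [Pi.sub_apply, Pi.smul_apply, smul_eq_mul, he]
    calc _ ≤ ENNReal.ofReal (∫ z, Real.exp (a f - 2 * X z f) ∂D) := ENNReal.ofReal_le_ofReal hj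
      _ = ∫⁻ z, ENNReal.ofReal (Real.exp (a f - 2 * X z f)) ∂D :=
          ofReal_integral_eq_lintegral_ofReal hi2
            (Filter.Eventually.of_forall fun z => (Real.exp_pos _).le)
      _ ≤ _ := lintegral_mono fun z => ENNReal.ofReal_le_ofReal
          (Real.exp_le_exp.2 (le_maxVal (a - (2 : ℝ) • X z) f))
  have hm1 : Measurable fun z => ENNReal.ofReal (Real.exp (maxVal (a + (2 : ℝ) • X z))) := by
    fun_prop
  calc _ ≤ ∫⁻ z, 2⁻¹ * (ENNReal.ofReal (Real.exp (maxVal (a + (2 : ℝ) • X z)))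
        + ENNReal.ofReal (Real.exp (maxVal (a - (2 : ℝ) • e)))) ∂D := by
        refine lintegral_mono fun z => ?_
        rw [← ofReal_average (Real.exp_pos _).le (Real.exp_pos _).le]
        exact ENNReal.ofReal_le_ofReal (exp_maxVal_add_sub_le _ _ _)
    _ ≤ _ := by
        rw [lintegral_const_mul _ (by fun_prop)]
        rw [lintegral_add_left hm1, lintegral_add_left hm1]
        gcongr 2⁻¹ * (_ + ?_)
        simpa using jensen

/-- Symmetrization: the exponential moment of the maximum of a centred empirical process is at
most that of the associated sign process. -/
theorem lintegral_exp_maxVal_sum_le (n : ℕ) {X : Z → F → ℝ} (hX : Measurable X) {B : ℝ}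
    (hB : ∀ z f, |X z f| ≤ B) (a : F → ℝ) :
    ∫⁻ S, ENNReal.ofReal (Real.exp (maxVal (a + ∑ i, (X (S i) - fun f => ∫ z, X z f ∂D))))
        ∂Measure.pi (fun _ : Fin n => D)
      ≤ ∫⁻ S, ENNReal.ofReal (signAvg (fun b => Real.exp (maxVal b)) a
          (List.ofFn fun i => (2 : ℝ) • X (S i))) ∂Measure.pi (fun _ : Fin n => D) := by
  have hmax : Measurable (maxVal : (F → ℝ) → ℝ) := measurable_maxVal
  have hΦ : Measurable fun b : F → ℝ => Real.exp (maxVal b) := by fun_prop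
  have hsg : ∀ (n : ℕ) {Ω : Type _} [MeasurableSpace Ω] (a : Ω → F → ℝ) (Y : Fin n → Ω → F → ℝ),
      Measurable a → (∀ i, Measurable (Y i)) → Measurable fun ω =>
        signAvg (fun b => Real.exp (maxVal b)) (a ω) (List.ofFn fun i => Y i ω) := by
    intro n Ω _ a Y ha hY
    have := Measurable.signAvg hΦ ha (xs := List.ofFn Y) (by simpa [List.mem_ofFn] using hY)
    simpa only [List.map_ofFn, Function.comp_def] using this
  have hpos : ∀ (a : F → ℝ) (xs : List (F → ℝ)),
      0 ≤ signAvg (fun b => Real.exp (maxVal b)) a xs := by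
    intro a xs
    induction xs generalizing a with
    | nil => exact (Real.exp_pos _).le
    | cons x xs ih => simp only [signAvg]; linarith [ih (a + x), ih (a - x)]
  set e : F → ℝ := fun f => ∫ z, X z f ∂D with he
  induction n generalizing a with
  | zero => simp [signAvg]
  | succ n ih =>
    have hsum : Measurable fun S : Fin n → Z => ∑ i, (X (S i) - e) := by fun_prop
    have m1 : Measurable fun p : Z × (Fin n → Z) => ENNReal.ofReal
        (Real.exp (maxVal (a + ((X p.1 - e) + ∑ i, (X (p.2 i) - e))))) := by
      fun_prop
    have m2 : Measurable fun p : (Fin n → Z) × Z => ENNReal.ofReal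
        (Real.exp (maxVal (a + ∑ i, (X (p.1 i) - e) + (2 : ℝ) • X p.2)))
        + ENNReal.ofReal
        (Real.exp (maxVal (a + ∑ i, (X (p.1 i) - e) - (2 : ℝ) • X p.2))) := by
      fun_prop
    rw [lintegral_pi_succ D (by fun_prop), lintegral_pi_succ D]
    · simp only [Fin.sum_univ_succ, Fin.cons_zero, Fin.cons_succ, List.ofFn_succ, signAvg]
      -- The first sample point is integrated innermost, so that the other centred terms act as a
      -- fixed offset. Once it has become a signed term it joins the offset `a` of the induction
      -- hypothesis.
      rw [lintegral_lintegral_swap m1.aemeasurable]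
      calc _ ≤ ∫⁻ S, 2⁻¹ * ∫⁻ z, (ENNReal.ofReal (Real.exp (maxVal
              (a + ∑ i, (X (S i) - e) + (2 : ℝ) • X z)))
            + ENNReal.ofReal (Real.exp (maxVal (a + ∑ i, (X (S i) - e) - (2 : ℝ) • X z)))) ∂D
              ∂Measure.pi (fun _ : Fin n => D) := by
            refine lintegral_mono fun S => ?_
            have := lintegral_exp_maxVal_center_le D hX hB (a + ∑ i, (X (S i) - e))
            refine le_trans (le_of_eq ?_) this
            refine lintegral_congr fun z => ?_
            rw [add_assoc, add_comm (∑ i, _)]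
        _ = 2⁻¹ * ∫⁻ z, ∫⁻ S, (ENNReal.ofReal (Real.exp (maxVal
              (a + (2 : ℝ) • X z + ∑ i, (X (S i) - e))))
            + ENNReal.ofReal (Real.exp (maxVal (a - (2 : ℝ) • X z + ∑ i, (X (S i) - e)))))
              ∂Measure.pi (fun _ : Fin n => D) ∂D := by
            rw [lintegral_const_mul _ m2.lintegral_prod_right', lintegral_lintegral_swap
              m2.aemeasurable]
            congr 1
            refine lintegral_congr fun z => lintegral_congr fun S => ?_
            rw [add_right_comm, add_sub_right_comm]
        _ ≤ 2⁻¹ * ∫⁻ z, ∫⁻ S, (ENNReal.ofReal (signAvg (fun b => Real.exp (maxVal b))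
              (a + (2 : ℝ) • X z) (List.ofFn fun i => (2 : ℝ) • X (S i)))
            + ENNReal.ofReal (signAvg (fun b => Real.exp (maxVal b))
              (a - (2 : ℝ) • X z) (List.ofFn fun i => (2 : ℝ) • X (S i))))
              ∂Measure.pi (fun _ : Fin n => D) ∂D := by
            gcongr 2⁻¹ * ?_
            refine lintegral_mono fun z => ?_
            rw [lintegral_add_left (by fun_prop), lintegral_add_left]
            · exact add_le_add (ih _) (ih _)
            · exact (hsg n _ _ measurable_const (by fun_prop)).ennreal_ofReal
        _ = _ := by
            rw [← lintegral_const_mul']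
            · refine lintegral_congr fun z => ?_
              rw [← lintegral_const_mul' _ _ (by simp)]
              refine lintegral_congr fun S => ?_
              rw [ofReal_average (hpos _ _) (hpos _ _)]
            · simp
    · exact (hsg (n + 1) _ _ measurable_const (by fun_prop)).ennreal_ofReal

end Independent

/-! ### Truncation levels and tail bounds for nonnegative variables -/

section Truncation

variable {Z : Type*} [MeasurableSpace Z] (D : Measure Z) [IsProbabilityMeasure D]

/-- A truncation level at which a given fraction of the mass is cut off, up to a factor. -/
theorem exists_truncation_level {g : Z → ℝ} (hg : Measurable g) (hg0 : ∀ z, 0 ≤ g z) {η : ℝ}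
    (hη : 0 < η) :
    ∃ R, 0 ≤ R ∧ D.real {z | R < g z} ≤ η ∧ R ^ 2 * η ≤ 4 * ∫ z, (min (g z) R) ^ 2 ∂D := by
  have : IsProbabilityMeasure (D.map g) := Measure.isProbabilityMeasure_map hg.aemeasurable
  set G := ProbabilityTheory.cdf (D.map g) with hG
  have hGr : ∀ r, D.real {z | r < g z} = 1 - G r := fun r => by
    rw [hG, ProbabilityTheory.cdf_eq_real, map_measureReal_apply hg measurableSet_Iic,
      ← probReal_compl_eq_one_sub (hg measurableSet_Iic)]
    congr 1; ext z; simp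
  set A : Set ℝ := {r | 0 ≤ r ∧ 1 - η ≤ G r} with hA
  have hne : A.Nonempty := by
    have h1 := ProbabilityTheory.tendsto_cdf_atTop (D.map g)
    have h2 := h1.eventually (eventually_ge_nhds (show 1 - η < 1 by linarith))
    obtain ⟨r, hr, hr0⟩ := (h2.and (Filter.eventually_ge_atTop 0)).exists
    exact ⟨r, hr0, hr⟩
  have hbdd : BddBelow A := ⟨0, fun r hr => hr.1⟩
  set R := sInf A with hR
  have hR0 : 0 ≤ R := le_csInf hne fun r hr => hr.1
  -- Right continuity of the distribution function puts the infimum itself in `A`. On the other hand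
  -- `R / 2` is not in `A`, so mass at least `η` lies above `R / 2`, which bounds the truncated
  -- second moment below.
  have hRG : 1 - η ≤ G R := by
    have hc := G.right_continuous R
    have hc' : Filter.Tendsto G (nhdsWithin R (Set.Ioi R)) (nhds (G R)) :=
      hc.mono_left (nhdsWithin_mono _ Set.Ioi_subset_Ici_self)
    refine ge_of_tendsto hc' ?_
    filter_upwards [self_mem_nhdsWithin] with r hr
    obtain ⟨r', hr', hlt⟩ := exists_lt_of_csInf_lt hne hr
    exact hr'.2.trans (G.mono hlt.le)
  refine ⟨R, hR0, by rw [hGr]; linarith, ?_⟩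
  have hmin : ∀ z, 0 ≤ min (g z) R := fun z => le_min (hg0 z) hR0
  rcases hR0.eq_or_lt with h0 | hpos
  · rw [← h0]
    have : 0 ≤ ∫ z, (min (g z) 0) ^ 2 ∂D := integral_nonneg fun z => sq_nonneg _
    linarith
  have hnot : R / 2 ∉ A := fun h => by
    have := csInf_le hbdd h
    linarith
  have hlarge : η ≤ D.real {z | R / 2 < g z} := by
    rw [hGr]
    by_contra! hcon
    exact hnot ⟨by positivity, by linarith⟩
  have hms : MeasurableSet {z | R / 2 < g z} := measurableSet_lt measurable_const hg
  have hint : Integrable (fun z => (min (g z) R) ^ 2) D :=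
    Integrable.of_bound (by fun_prop) (R ^ 2) (Filter.Eventually.of_forall fun z => by
      rw [Real.norm_eq_abs, abs_of_nonneg (sq_nonneg _)]
      exact pow_le_pow_left₀ (hmin z) (min_le_right _ _) 2)
  have hle : ∫ z, Set.indicator {z | R / 2 < g z} (fun _ => (R / 2) ^ 2) z ∂D
      ≤ ∫ z, (min (g z) R) ^ 2 ∂D := by
    refine integral_mono ((integrable_const _).indicator hms) hint fun z => ?_
    by_cases hz : R / 2 < g z
    · rw [Set.indicator_of_mem (by exact hz)]
      exact pow_le_pow_left₀ (by positivity) (le_min hz.le (by linarith)) 2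
    · rw [Set.indicator_of_notMem (by exact hz)]
      exact sq_nonneg _
  rw [integral_indicator_const _ hms, smul_eq_mul] at hle
  nlinarith [mul_le_mul_of_nonneg_right hlarge (sq_nonneg R)]

/-- Lower tail bound for the empirical second moment. -/
theorem measure_sum_sq_lt_le {g : Z → ℝ} (hg : Measurable g) (hg0 : ∀ z, 0 ≤ g z) {η R : ℝ}
    (hR0 : 0 ≤ R) (hR : R ^ 2 * η ≤ 4 * ∫ z, (min (g z) R) ^ 2 ∂D) (n : ℕ) {ε : ℝ} (hε : 0 < ε)
    (hn : 16 * Real.log (1 / ε) ≤ n * η) :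
    Measure.pi (fun _ : Fin n => D)
      {S | ∑ i, g (S i) ^ 2 < n * (∫ z, (min (g z) R) ^ 2 ∂D) / 4} ≤ ENNReal.ofReal ε := by
  rcases hR0.eq_or_lt with h0 | hpos
  · have : {S : Fin n → Z | ∑ i, g (S i) ^ 2 < n * (∫ z, (min (g z) R) ^ 2 ∂D) / 4} = ∅ := by
      ext S
      simp only [← h0, Set.mem_ofPred_eq, Set.mem_empty_iff_false, iff_false, not_lt]
      have h1 : ∀ z, min (g z) 0 = 0 := fun z => min_eq_right (hg0 z)
      simp only [h1]
      simp only [ne_eq, OfNat.ofNat_ne_zero, not_false_eq_true, zero_pow, integral_zero, mul_zero,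
        zero_div]
      positivity
    simp [this]
  set s := ∫ z, (min (g z) R) ^ 2 ∂D with hs
  have hmin : ∀ z, 0 ≤ min (g z) R := fun z => le_min (hg0 z) hR0
  set Y : Z → ℝ := fun z => -(min (g z) R / R) ^ 2 with hY
  have hYm : Measurable Y := by fun_prop
  have hY1 : ∀ z, -1 ≤ Y z := fun z => by
    have : (min (g z) R / R) ^ 2 ≤ 1 ^ 2 :=
      pow_le_pow_left₀ (by have := hmin z; positivity)
        ((div_le_one hpos).2 (min_le_right _ _)) 2
    simp only [hY]; linarith
  have hY0 : ∀ z, Y z ≤ 0 := fun z => by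
    have := sq_nonneg (min (g z) R / R)
    simp only [hY]; linarith
  have hint : Integrable Y D := Integrable.of_bound hYm.aestronglyMeasurable 1
    (Filter.Eventually.of_forall fun z => by
      rw [Real.norm_eq_abs, abs_le]; exact ⟨hY1 z, by linarith [hY0 z]⟩)
  have hYs : ∫ z, Y z ∂D = -(s / R ^ 2) := by
    simp only [hY, integral_neg, div_pow, integral_div, hs]
  -- On `[-1, 0]` the exponential lies below its chord, whose slope is `1 - exp (-1) ≥ 1 / 2`.
  have hexp : ∀ z, Real.exp (Y z) ≤ 1 + Y z / 2 := fun z => by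
    have hc := convexOn_exp.2 (Set.mem_univ (-1 : ℝ)) (Set.mem_univ (0 : ℝ))
      (show 0 ≤ -Y z by linarith [hY0 z]) (show 0 ≤ 1 + Y z by linarith [hY1 z]) (by ring)
    simp only [smul_eq_mul, mul_zero, add_zero, Real.exp_zero] at hc
    have h2 : Real.exp (-1) ≤ 1 / 2 := by
      rw [Real.exp_neg, ← one_div]
      exact one_div_le_one_div_of_le (by norm_num) (by linarith [Real.add_one_le_exp (1 : ℝ)])
    rw [show -Y z * -1 = Y z by ring] at hc
    nlinarith [hY0 z]
  have h := measure_sum_gt_le D n hYm hε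
    (lintegral_exp_le_of_forall_le D (hint.div_const 2) hexp le_rfl)
  refine (measure_mono fun S hS => ?_).trans h
  simp only [Set.mem_ofPred_eq] at hS ⊢
  rw [integral_div, hYs]
  have hsum : -((∑ i, g (S i) ^ 2) / R ^ 2) ≤ ∑ i, Y (S i) := by
    rw [Finset.sum_div, ← Finset.sum_neg_distrib]
    refine Finset.sum_le_sum fun i _ => ?_
    simp only [hY, div_pow]
    gcongr
    · exact hmin _
    · exact min_le_left _ _
  have h1 : (∑ i, g (S i) ^ 2) / R ^ 2 < n * (s / R ^ 2) / 4 := by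
    rw [div_lt_iff₀ (by positivity)]
    refine hS.trans_le (le_of_eq ?_)
    field_simp
  -- The gap between half and a quarter of `n * s / R ^ 2` is then at least `n * η / 16`, which pays
  -- for `log (1 / ε)`.
  have h2 : η / 4 ≤ s / R ^ 2 := by
    rw [le_div_iff₀ (by positivity)]
    linarith
  have h3 : n * (η / 4) ≤ n * (s / R ^ 2) := by gcongr
  have h4 : (n : ℝ) * (-(s / R ^ 2) / 2) = -(n * (s / R ^ 2)) / 2 := by ring
  rw [h4]
  linarith

/-- Upper tail bound for the number of sample points in a set. -/
theorem measure_count_gt_le {A : Set Z} (hA : MeasurableSet A) {η : ℝ} (hη : D.real A ≤ η)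
    (n : ℕ) {ε : ℝ} (hε : 0 < ε) :
    Measure.pi (fun _ : Fin n => D)
      {S | n * (2 * η) + Real.log (1 / ε) < ∑ i, A.indicator (fun _ => (1 : ℝ)) (S i)}
      ≤ ENNReal.ofReal ε := by
  have hi : Integrable (A.indicator fun _ => (1 : ℝ)) D := (integrable_const _).indicator hA
  refine measure_sum_gt_le D n (measurable_const.indicator hA) hε
    (lintegral_exp_le_of_forall_le D (hi.const_mul 2) (fun z => ?_) ?_)
  · by_cases hz : z ∈ A
    · simp only [Set.indicator_of_mem hz]
      -- On the set the requirement is `exp 1 ≤ 1 + 2`, the source of the factor two in `2 * η`.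
      linarith [Real.exp_one_lt_d9]
    · simp [Set.indicator_of_notMem hz]
  · rw [integral_const_mul, integral_indicator_const _ hA, smul_eq_mul, mul_one]
    linarith

end Truncation

/-! ### Rademacher complexity of two layer networks -/

section Network

theorem euclNorm_nonneg {n : ℕ} (v : Fin n → ℝ) : 0 ≤ euclNorm v := norm_nonneg _

theorem euclNorm_sq {n : ℕ} (v : Fin n → ℝ) : euclNorm v ^ 2 = ∑ k, v k ^ 2 := by
  simp [euclNorm, EuclideanSpace.norm_sq_eq]

theorem dotProduct_eq_inner {n : ℕ} (u v : Fin n → ℝ) :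
    u ⬝ᵥ v = inner ℝ (WithLp.toLp 2 u) (WithLp.toLp 2 v) := by
  simp [dotProduct, PiLp.inner_apply, mul_comm]

theorem abs_dotProduct_le {n : ℕ} (u v : Fin n → ℝ) : |u ⬝ᵥ v| ≤ euclNorm u * euclNorm v := by
  rw [dotProduct_eq_inner]
  exact abs_real_inner_le_norm _ _

theorem abs_apply_le_euclNorm {n : ℕ} (v : Fin n → ℝ) (k : Fin n) : |v k| ≤ euclNorm v := by
  have := PiLp.norm_apply_le (WithLp.toLp 2 v) k
  simpa [euclNorm] using this

theorem reluNet_apply {d h c : ℕ} (V : Matrix (Fin c) (Fin h) ℝ) (U : Matrix (Fin h) (Fin d) ℝ)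
    (x : Fin d → ℝ) (k : Fin c) : reluNet V U x k = ∑ j, V k j * max (U j ⬝ᵥ x) 0 := rfl

theorem list_sum_flatMap {ι : Type*} (I : List ι) (g : ι → List ℝ) :
    (I.flatMap g).sum = (I.map fun i => (g i).sum).sum := by
  induction I with
  | nil => rfl
  | cons i I ih => simp [List.flatMap_cons, ih]

/-- All pairs of indices, in lexicographic order. -/
def indexPairs (m c : ℕ) : List (Fin m × Fin c) :=
  (List.finRange m).flatMap fun i => (List.finRange c).map fun k => (i, k)

theorem sum_indexPairs {m c : ℕ} (g : Fin m × Fin c → ℝ) :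
    ((indexPairs m c).map g).sum = ∑ i, ∑ k, g (i, k) := by
  rw [indexPairs, List.map_flatMap, list_sum_flatMap, Fin.sum_univ_def]
  simp only [List.map_map, Fin.sum_univ_def]
  rfl

theorem abs_mul_relu_sub_le {v v' s s' a ρ : ℝ} (hv' : |v'| ≤ a) (hs : |s| ≤ ρ) :
    |v * max s 0 - v' * max s' 0| ≤ ρ * |v - v'| + a * |s - s'| := by
  have h1 : v * max s 0 - v' * max s' 0 = max s 0 * (v - v') + v' * (max s 0 - max s' 0) := by ring
  rw [h1]
  refine (abs_add_le _ _).trans ?_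
  rw [abs_mul, abs_mul]
  have h2 : |max s 0| ≤ ρ := by
    rw [abs_of_nonneg (le_max_right _ _)]
    exact max_le ((le_abs_self _).trans hs) ((abs_nonneg _).trans hs)
  have h3 : |max s 0 - max s' 0| ≤ |s - s'| := abs_max_sub_max_le_abs s s' 0
  have h4 := (abs_nonneg _).trans hv'
  gcongr

theorem sqrt_sum_add_sq_le {ι : Type*} [Fintype ι] (p q : ι → ℝ) :
    Real.sqrt (∑ i, (p i + q i) ^ 2) ≤ Real.sqrt (∑ i, p i ^ 2) + Real.sqrt (∑ i, q i ^ 2) := by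
  have h := norm_add_le (WithLp.toLp 2 p) (WithLp.toLp 2 q)
  simpa [EuclideanSpace.norm_eq] using h

theorem sqrt_sum_mul_sq {ι : Type*} [Fintype ι] {b : ℝ} (hb : 0 ≤ b) (p : ι → ℝ) :
    Real.sqrt (∑ i, (b * p i) ^ 2) = b * Real.sqrt (∑ i, p i ^ 2) := by
  simp only [mul_pow, ← Finset.mul_sum]
  rw [Real.sqrt_mul (by positivity), Real.sqrt_sq hb]

variable {F : Type*} [Fintype F] [Nonempty F]

/-- Sign average of a single neuron with vector valued output. -/
theorem signAvg_neuron_le {m c d : ℕ} (x : Fin m → Fin d → ℝ) (v : F → Fin c → ℝ)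
    (Δ : F → Fin d → ℝ) (t : F → ℝ) (u₀ : Fin d → ℝ) {a r τ κ : ℝ} (hκ : 0 ≤ κ)
    (hv : ∀ f, euclNorm (v f) ≤ a) (hΔ : ∀ f, euclNorm (Δ f) ≤ r) (ht : ∀ f, |t f| ≤ τ) :
    signAvg maxVal 0 ((indexPairs m c).map fun p f =>
        κ * (v f p.2 * max ((t f • u₀ + Δ f) ⬝ᵥ x p.1) 0))
      ≤ 4 * κ * a * Real.sqrt c * (r * Real.sqrt (∑ i, euclNorm (x i) ^ 2)
        + τ * Real.sqrt (∑ i, (u₀ ⬝ᵥ x i) ^ 2)) := by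
  have f₀ := Classical.arbitrary F
  have ha : 0 ≤ a := (euclNorm_nonneg _).trans (hv f₀)
  have hr : 0 ≤ r := (euclNorm_nonneg _).trans (hΔ f₀)
  have hτ : 0 ≤ τ := (abs_nonneg _).trans (ht f₀)
  set ρ : Fin m → ℝ := fun i => r * euclNorm (x i) + τ * |u₀ ⬝ᵥ x i| with hρ
  have hρ0 : ∀ i, 0 ≤ ρ i := fun i => by have := euclNorm_nonneg (x i); positivity
  have hdot : ∀ f i, |(t f • u₀ + Δ f) ⬝ᵥ x i| ≤ ρ i := fun f i => by
    rw [add_dotProduct, smul_dotProduct, smul_eq_mul, add_comm]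
    refine (abs_add_le _ _).trans (add_le_add ((abs_dotProduct_le _ _).trans ?_) ?_)
    · exact mul_le_mul_of_nonneg_right (hΔ f) (euclNorm_nonneg _)
    · rw [abs_mul]; exact mul_le_mul_of_nonneg_right (ht f) (abs_nonneg _)
  -- An increment of the product `v * max s 0` is at most a sum of an increment in `v` and one in
  -- `s`, hence at most twice the larger. This gives two linear replacements, each with the factor
  -- 2.
  set g : Fin m × Fin c → List (F → ℝ) := fun p =>
    [fun f => 2 * κ * ρ p.1 * v f p.2, fun f => 2 * κ * a * ((t f • u₀ + Δ f) ⬝ᵥ x p.1)] with hg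
  -- Each index is doubled, one copy for each replacement. Padding with zeros splits the process
  -- into three linear ones, in `v`, `Δ` and `t`.
  set J := (indexPairs m c).flatMap fun p => [(p, true), (p, false)] with hJ
  have hsumJ : ∀ w : (Fin m × Fin c) × Bool → ℝ,
      (J.map w).sum = ∑ i, ∑ k, (w ((i, k), true) + w ((i, k), false)) := fun w => by
    rw [← sum_indexPairs fun p => w (p, true) + w (p, false), hJ, List.map_flatMap,
      list_sum_flatMap]
    simp
  have hflat : (indexPairs m c).flatMap g = J.map fun q f =>
      (inner ℝ (WithLp.toLp 2 (v f)) (if q.2 then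
          EuclideanSpace.single q.1.2 (2 * κ * ρ q.1.1) else (0 : EuclideanSpace ℝ (Fin c))))
      + (inner ℝ (WithLp.toLp 2 (Δ f)) (if q.2 then (0 : EuclideanSpace ℝ (Fin d)) else
          (2 * κ * a) • WithLp.toLp 2 (x q.1.1))
      + inner ℝ (t f) (if q.2 then (0 : ℝ) else 2 * κ * a * (u₀ ⬝ᵥ x q.1.1))) := by
    rw [hJ, List.map_flatMap]
    congr 1
    ext1 p
    simp only [hg, List.map_cons, List.map_nil, if_true, Bool.false_eq_true, if_false,
      inner_zero_right, add_zero, zero_add, inner_smul_right, ← dotProduct_eq_inner,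
      EuclideanSpace.inner_single_right, add_dotProduct, smul_dotProduct, smul_eq_mul]
    congr 2
    ext f
    simp
    ring
  have hA := signAvg_maxVal_inner_le J (fun f => WithLp.toLp 2 (v f)) hv 0
    (fun q => if q.2 then EuclideanSpace.single q.1.2 (2 * κ * ρ q.1.1) else 0)
  have hB := signAvg_maxVal_inner_le J (fun f => WithLp.toLp 2 (Δ f)) hΔ 0
    (fun q => if q.2 then 0 else (2 * κ * a) • WithLp.toLp 2 (x q.1.1))
  have hC := signAvg_maxVal_inner_le J t (fun f => by simpa using ht f) 0
    (fun q => if q.2 then 0 else 2 * κ * a * (u₀ ⬝ᵥ x q.1.1))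
  rw [hsumJ] at hA hB hC
  simp only [inner_zero_right, norm_zero, if_true, Bool.false_eq_true, if_false, norm_smul,
    PiLp.norm_single, Finset.sum_const, Finset.card_univ, Fintype.card_fin, ne_eq,
    OfNat.ofNat_ne_zero, not_false_eq_true, zero_pow, zero_add, add_zero, nsmul_eq_mul, mul_pow,
    Real.norm_eq_abs, sq_abs, ← Finset.mul_sum] at hA hB hC
  have hsA : Real.sqrt (c * (2 ^ 2 * κ ^ 2 * ∑ i, ρ i ^ 2))
      = 2 * κ * Real.sqrt c * Real.sqrt (∑ i, ρ i ^ 2) := by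
    rw [Real.sqrt_mul (by positivity), Real.sqrt_mul (by positivity), ← mul_pow,
      Real.sqrt_sq (by positivity)]
    ring
  have hsρ : Real.sqrt (∑ i, ρ i ^ 2) ≤ r * Real.sqrt (∑ i, euclNorm (x i) ^ 2)
      + τ * Real.sqrt (∑ i, (u₀ ⬝ᵥ x i) ^ 2) := by
    refine (sqrt_sum_add_sq_le _ _).trans (le_of_eq ?_)
    rw [sqrt_sum_mul_sq hr, sqrt_sum_mul_sq hτ]
    simp only [sq_abs]
  set P := Real.sqrt (∑ i, euclNorm (x i) ^ 2) with hP
  set T := Real.sqrt (∑ i, (u₀ ⬝ᵥ x i) ^ 2) with hT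
  have hsB : Real.sqrt (c * (2 ^ 2 * κ ^ 2 * a ^ 2 * ∑ i, euclNorm (x i) ^ 2))
      = 2 * κ * a * Real.sqrt c * P := by
    rw [Real.sqrt_mul (by positivity), Real.sqrt_mul (by positivity), ← mul_pow, ← mul_pow,
      Real.sqrt_sq (by positivity)]
    ring
  have hsC : Real.sqrt (c * (2 ^ 2 * κ ^ 2 * a ^ 2 * ∑ i, (u₀ ⬝ᵥ x i) ^ 2))
      = 2 * κ * a * Real.sqrt c * T := by
    rw [Real.sqrt_mul (by positivity), Real.sqrt_mul (by positivity), ← mul_pow, ← mul_pow,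
      Real.sqrt_sq (by positivity)]
    ring
  rw [hsA] at hA
  erw [hsB] at hB
  rw [hsC] at hC
  have hcontract := signAvg_maxVal_contract (indexPairs m c) (0 : F → ℝ) (fun p f =>
    κ * (v f p.2 * max ((t f • u₀ + Δ f) ⬝ᵥ x p.1) 0)) g (fun p f f' => by
      have h1 := abs_mul_relu_sub_le (s' := (t f' • u₀ + Δ f') ⬝ᵥ x p.1) (v := v f p.2)
        ((abs_apply_le_euclNorm (v f') p.2).trans (hv f')) (hdot f p.1)
      have h2 : |κ * (v f p.2 * max ((t f • u₀ + Δ f) ⬝ᵥ x p.1) 0)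
          - κ * (v f' p.2 * max ((t f' • u₀ + Δ f') ⬝ᵥ x p.1) 0)|
          ≤ κ * (ρ p.1 * |v f p.2 - v f' p.2|
            + a * |(t f • u₀ + Δ f) ⬝ᵥ x p.1 - (t f' • u₀ + Δ f') ⬝ᵥ x p.1|) := by
        rw [← mul_sub, abs_mul, abs_of_nonneg hκ]
        gcongr
      rcases le_total (ρ p.1 * |v f p.2 - v f' p.2|)
        (a * |(t f • u₀ + Δ f) ⬝ᵥ x p.1 - (t f' • u₀ + Δ f') ⬝ᵥ x p.1|) with hle | hle
      · refine ⟨_, by simp only [hg, List.mem_cons]; exact Or.inr (Or.inl rfl), h2.trans ?_⟩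
        rw [← mul_sub, abs_mul, abs_of_nonneg (by positivity : 0 ≤ 2 * κ * a)]
        nlinarith
      · refine ⟨_, by simp only [hg, List.mem_cons]; exact Or.inl rfl, h2.trans ?_⟩
        rw [← mul_sub, abs_mul, abs_of_nonneg (by have := hρ0 p.1; positivity :
          0 ≤ 2 * κ * ρ p.1)]
        nlinarith)
  refine hcontract.trans ?_
  rw [hflat]
  have s1 := signAvg_maxVal_add_le J (0 : F → ℝ) 0
    (fun q f => inner ℝ (WithLp.toLp 2 (v f)) (if q.2 then
          EuclideanSpace.single q.1.2 (2 * κ * ρ q.1.1) else (0 : EuclideanSpace ℝ (Fin c))))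
    (fun q f => inner ℝ (WithLp.toLp 2 (Δ f)) (if q.2 then (0 : EuclideanSpace ℝ (Fin d)) else
          (2 * κ * a) • WithLp.toLp 2 (x q.1.1))
      + inner ℝ (t f) (if q.2 then (0 : ℝ) else 2 * κ * a * (u₀ ⬝ᵥ x q.1.1)))
  have s2 := signAvg_maxVal_add_le J (0 : F → ℝ) 0
    (fun q f => inner ℝ (WithLp.toLp 2 (Δ f)) (if q.2 then (0 : EuclideanSpace ℝ (Fin d)) else
          (2 * κ * a) • WithLp.toLp 2 (x q.1.1)))
    (fun q f => inner ℝ (t f) (if q.2 then (0 : ℝ) else 2 * κ * a * (u₀ ⬝ᵥ x q.1.1)))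
  rw [add_zero] at s1 s2
  refine s1.trans ((add_le_add hA (s2.trans (add_le_add hB hC))).trans ?_)
  have hK : 0 ≤ 2 * κ * a * Real.sqrt c := by positivity
  nlinarith [mul_le_mul_of_nonneg_left hsρ hK]

theorem sum_sqrt_le {h : ℕ} (w : Fin h → ℝ) (hw : ∀ j, 0 ≤ w j) :
    ∑ j, Real.sqrt (w j) ≤ Real.sqrt h * Real.sqrt (∑ j, w j) := by
  rw [← Real.sqrt_mul (Nat.cast_nonneg h)]
  apply Real.le_sqrt_of_sq_le
  have := sq_sum_le_card_mul_sum_sq (s := Finset.univ) (f := fun j => Real.sqrt (w j))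
  simpa [Real.sq_sqrt (hw _)] using this

/-- Sign average of a loss composed with two layer networks. -/
theorem signAvg_reluNet_le {m c d h : ℕ} (x : Fin m → Fin d → ℝ) (ψ : Fin m → F → ℝ)
    (V : F → Matrix (Fin c) (Fin h) ℝ) (Δ : F → Matrix (Fin h) (Fin d) ℝ) (t : F → ℝ)
    (U₀ : Matrix (Fin h) (Fin d) ℝ) {a r τ κ : ℝ} (hκ : 0 ≤ κ) (ha : 0 ≤ a)
    (hV : ∀ f j, euclNorm ((V f).transpose j) ≤ a) (hΔ : ∀ f j, euclNorm (Δ f j) ≤ r)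
    (ht : ∀ f, |t f| ≤ τ)
    (hψ : ∀ i f f', ∃ k, |ψ i f - ψ i f'| ≤ κ * |reluNet (V f) (t f • U₀ + Δ f) (x i) k
      - reluNet (V f') (t f' • U₀ + Δ f') (x i) k|) :
    signAvg maxVal 0 (List.ofFn ψ)
      ≤ 4 * κ * a * Real.sqrt c * (h * r * Real.sqrt (∑ i, euclNorm (x i) ^ 2)
        + Real.sqrt h * τ * Real.sqrt (∑ i, euclNorm (U₀.mulVec (x i)) ^ 2)) := by
  have hτ : 0 ≤ τ := (abs_nonneg _).trans (ht (Classical.arbitrary F))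
  -- The increment of the loss is controlled by one output coordinate depending on the pair of
  -- networks. Every coordinate receives its own sign, which is where the factor `√c` arises.
  have h1 := signAvg_maxVal_contract (List.finRange m) (0 : F → ℝ) ψ
    (fun i => (List.finRange c).map fun k f => κ * reluNet (V f) (t f • U₀ + Δ f) (x i) k)
    (fun i f f' => by
      obtain ⟨k, hk⟩ := hψ i f f'
      refine ⟨_, List.mem_map.2 ⟨k, List.mem_finRange k, rfl⟩, hk.trans (le_of_eq ?_)⟩
      rw [← mul_sub, abs_mul, abs_of_nonneg hκ])
  have h2 : (List.finRange m).flatMap (fun i => (List.finRange c).map fun k f =>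
        κ * reluNet (V f) (t f • U₀ + Δ f) (x i) k)
      = (indexPairs m c).map fun p => ∑ j, fun f =>
        κ * ((V f).transpose j p.2 * max ((t f • U₀ j + Δ f j) ⬝ᵥ x p.1) 0) := by
    rw [indexPairs, List.map_flatMap]
    congr 1
    ext1 i
    rw [List.map_map]
    refine List.map_congr_left fun k _ => ?_
    ext f
    simp only [Function.comp_apply, Finset.sum_apply, reluNet_apply, Finset.mul_sum]
    rfl
  rw [← List.ofFn_eq_map] at h1
  rw [h2] at h1
  refine h1.trans ((signAvg_maxVal_sum_le _ _ _).trans ?_)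
  refine (Finset.sum_le_sum fun j _ => signAvg_neuron_le x (fun f => (V f).transpose j)
    (fun f => Δ f j) t (U₀ j) hκ (fun f => hV f j) (fun f => hΔ f j) ht).trans ?_
  rw [← Finset.mul_sum, Finset.sum_add_distrib, ← Finset.mul_sum, ← Finset.mul_sum]
  have h3 := sum_sqrt_le (fun j => ∑ i, (U₀ j ⬝ᵥ x i) ^ 2) (fun j => by positivity)
  have h4 : ∑ j, ∑ i, (U₀ j ⬝ᵥ x i) ^ 2 = ∑ i, euclNorm (U₀.mulVec (x i)) ^ 2 := by
    rw [Finset.sum_comm]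
    refine Finset.sum_congr rfl fun i _ => ?_
    rw [euclNorm_sq]
    rfl
  rw [h4] at h3
  simp only [Finset.sum_const, Finset.card_univ, Fintype.card_fin, nsmul_eq_mul]
  gcongr ?_ * ?_
  have h5 := mul_le_mul_of_nonneg_left h3 hτ
  nlinarith

end Network

/-! ### The clipped margin and pointwise bounds on networks -/

section Loss

/-- The complement of the ramp loss: the margin divided by `γ` and clipped to `[0, 1]`. -/
noncomputable def clip (γ t : ℝ) : ℝ := max 0 (min 1 (t / γ))

theorem clip_nonneg (γ t : ℝ) : 0 ≤ clip γ t := le_max_left _ _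

theorem clip_le_one (γ t : ℝ) : clip γ t ≤ 1 := max_le zero_le_one (min_le_left _ _)

theorem clip_zero (γ : ℝ) : clip γ 0 = 0 := by simp [clip]

theorem ramp_eq_one_sub_clip {γ : ℝ} (hγ : 0 < γ) (t : ℝ) : ramp γ t = 1 - clip γ t := by
  unfold ramp clip
  split_ifs with h1 h2
  · rw [min_eq_left ((one_le_div hγ).2 h1.le)]; simp
  · rw [max_eq_left ((min_le_right _ _).trans (div_nonpos_of_nonpos_of_nonneg h2.le hγ.le))]; simp
  · rw [min_eq_right ((div_le_one hγ).2 (not_lt.1 h1)),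
      max_eq_right (div_nonneg (not_lt.1 h2) hγ.le)]

theorem clip_le_one_sub_ramp_zero {γ : ℝ} (hγ : 0 < γ) (t : ℝ) : clip γ t ≤ 1 - ramp 0 t := by
  rw [ramp_zero]
  split_ifs with h
  · rw [clip, max_eq_left ((min_le_right _ _).trans (div_nonpos_of_nonpos_of_nonneg h hγ.le))]
    simp
  · simpa using clip_le_one γ t

theorem abs_clip_sub_clip_le {γ : ℝ} (hγ : 0 < γ) (s t : ℝ) :
    |clip γ s - clip γ t| ≤ |s - t| / γ := by
  have h1 : |clip γ s - clip γ t| ≤ |min 1 (s / γ) - min 1 (t / γ)| := by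
    simpa only [clip, max_comm (0 : ℝ)] using
      abs_max_sub_max_le_abs (min 1 (s / γ)) (min 1 (t / γ)) 0
  have h2 : |min 1 (s / γ) - min 1 (t / γ)| ≤ |s / γ - t / γ| := by
    have := abs_min_sub_min_le_max 1 (s / γ) 1 (t / γ)
    simpa using this
  refine h1.trans (h2.trans (le_of_eq ?_))
  rw [← sub_div, abs_div, abs_of_pos hγ]

/-- Below `γ` the upper clipping is inactive, and the positive part is homogeneous. This is what
permits rescaling small networks. -/
theorem clip_mul_of_le {γ : ℝ} (hγ : 0 < γ) {b t : ℝ} (hb0 : 0 ≤ b) (hb1 : b ≤ 1) (ht : t ≤ γ) :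
    clip γ (b * t) = b * clip γ t := by
  have h1 : t / γ ≤ 1 := (div_le_one hγ).2 ht
  have h2 : b * (t / γ) ≤ 1 := by nlinarith
  rw [clip, clip, mul_div_assoc, min_eq_right h1, min_eq_right h2, mul_max_of_nonneg _ _ hb0,
    mul_zero]

theorem continuous_clip (γ : ℝ) : Continuous (clip γ) := by
  unfold clip; fun_prop

theorem exists_abs_margin_sub_le {c : ℕ} (hc : 2 ≤ c) (s s' : Fin c → ℝ) (y : Fin c) :
    ∃ k, |margin s y - margin s' y| ≤ 2 * |s k - s' k| := by
  obtain ⟨k, -, hk⟩ := Finset.exists_max_image Finset.univ (fun k => |s k - s' k|)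
    ⟨y, Finset.mem_univ y⟩
  refine ⟨k, ?_⟩
  have : Nonempty {i : Fin c // i ≠ y} := by
    have : Nontrivial (Fin c) := Fin.nontrivial_iff_two_le.2 hc
    obtain ⟨i, hi⟩ := exists_ne y
    exact ⟨⟨i, hi⟩⟩
  have key : ∀ u v : Fin c → ℝ, (∀ i, |u i - v i| ≤ |s k - s' k|) →
      (⨆ i : {i : Fin c // i ≠ y}, u i) ≤ (⨆ i : {i : Fin c // i ≠ y}, v i) + |s k - s' k| := by
    intro u v huv
    refine ciSup_le fun i => ?_
    have h1 := le_ciSup (Set.finite_range fun i : {i : Fin c // i ≠ y} => v i).bddAbove i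
    have h2 := (abs_le.1 (huv i)).2
    linarith
  have h1 := key s s' fun i => hk i (Finset.mem_univ i)
  have h2 := key s' s fun i => by rw [abs_sub_comm]; exact hk i (Finset.mem_univ i)
  have h3 := abs_le.1 (hk y (Finset.mem_univ y))
  unfold margin
  rw [abs_le]
  constructor <;> linarith [h3.1, h3.2]

theorem margin_zero {c : ℕ} (y : Fin c) : margin (0 : Fin c → ℝ) y = 0 := by
  simp [margin]

theorem margin_smul {c : ℕ} {b : ℝ} (hb : 0 ≤ b) (s : Fin c → ℝ) (y : Fin c) :
    margin (b • s) y = b * margin s y := by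
  simp only [margin, Pi.smul_apply, smul_eq_mul, mul_sub, Real.mul_iSup_of_nonneg hb]

theorem continuous_margin {c : ℕ} (hc : 2 ≤ c) (y : Fin c) :
    Continuous fun s : Fin c → ℝ => margin s y := by
  have : LipschitzWith 2 fun s : Fin c → ℝ => margin s y := by
    refine LipschitzWith.of_dist_le_mul fun s s' => ?_
    obtain ⟨k, hk⟩ := exists_abs_margin_sub_le hc s s' y
    rw [Real.dist_eq]
    refine hk.trans ?_
    have := dist_le_pi_dist s s' k
    rw [Real.dist_eq] at this
    push_cast
    linarith
  exact this.continuous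

theorem measurable_margin_comp {d c : ℕ} (hc : 2 ≤ c) {f : (Fin d → ℝ) → Fin c → ℝ}
    (hf : Measurable f) : Measurable fun z : (Fin d → ℝ) × Fin c => margin (f z.1) z.2 :=
  measurable_from_prod_countable_left fun y => (continuous_margin hc y).measurable.comp hf

theorem measurable_reluNet {d h c : ℕ} (V : Matrix (Fin c) (Fin h) ℝ)
    (U : Matrix (Fin h) (Fin d) ℝ) : Measurable (reluNet V U) := by
  refine measurable_pi_lambda _ fun k => ?_
  simp only [reluNet_apply, dotProduct]
  fun_prop

theorem continuous_euclNorm {n : ℕ} : Continuous (euclNorm : (Fin n → ℝ) → ℝ) := by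
  have : (euclNorm : (Fin n → ℝ) → ℝ) = fun v => Real.sqrt (∑ k, v k ^ 2) := by
    ext v
    rw [← euclNorm_sq, Real.sqrt_sq (euclNorm_nonneg v)]
  rw [this]
  fun_prop

theorem reluNet_zero {d h c : ℕ} (V : Matrix (Fin c) (Fin h) ℝ)
    (U : Matrix (Fin h) (Fin d) ℝ) : reluNet V U 0 = 0 := by
  ext k
  simp [reluNet_apply]

theorem reluNet_smul {d h c : ℕ} (b : ℝ) (V : Matrix (Fin c) (Fin h) ℝ)
    (U : Matrix (Fin h) (Fin d) ℝ) (x : Fin d → ℝ) : reluNet (b • V) U x = b • reluNet V U x := by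
  ext k
  simp [reluNet_apply, Finset.mul_sum, mul_assoc]

theorem abs_reluNet_le {d h c : ℕ} {V : Matrix (Fin c) (Fin h) ℝ}
    {U : Matrix (Fin h) (Fin d) ℝ} {x : Fin d → ℝ} {a : ℝ}
    (hV : ∀ j, euclNorm (V.transpose j) ≤ a) {ρ : Fin h → ℝ} (hρ : ∀ j, |U j ⬝ᵥ x| ≤ ρ j)
    (k : Fin c) : |reluNet V U x k| ≤ a * ∑ j, ρ j := by
  rw [reluNet_apply, Finset.mul_sum]
  refine (Finset.abs_sum_le_sum_abs _ _).trans (Finset.sum_le_sum fun j _ => ?_)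
  rw [abs_mul]
  have h1 : |V k j| ≤ a := (abs_apply_le_euclNorm (V.transpose j) k).trans (hV j)
  have h2 : |max (U j ⬝ᵥ x) 0| ≤ ρ j := by
    rw [abs_of_nonneg (le_max_right _ _)]
    exact max_le ((le_abs_self _).trans (hρ j)) ((abs_nonneg _).trans (hρ j))
  have h3 := (abs_nonneg _).trans h1
  gcongr

theorem sum_abs_dotProduct_le {d h : ℕ} (U : Matrix (Fin h) (Fin d) ℝ) (x : Fin d → ℝ) :
    ∑ j, |U j ⬝ᵥ x| ≤ Real.sqrt h * euclNorm (U.mulVec x) := by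
  have := sum_sqrt_le (fun j => (U j ⬝ᵥ x) ^ 2) (fun j => by positivity)
  simp only [Real.sqrt_sq_eq_abs] at this
  refine this.trans (le_of_eq ?_)
  rw [← Real.sqrt_sq (euclNorm_nonneg (U.mulVec x)), euclNorm_sq]
  rfl

theorem abs_reluNet_add_le {d h c : ℕ} {V : Matrix (Fin c) (Fin h) ℝ}
    {Δ U₀ : Matrix (Fin h) (Fin d) ℝ} {a r τ t : ℝ} (ha : 0 ≤ a)
    (hV : ∀ j, euclNorm (V.transpose j) ≤ a) (hΔ : ∀ j, euclNorm (Δ j) ≤ r) (ht : |t| ≤ τ)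
    (x : Fin d → ℝ) (k : Fin c) :
    |reluNet V (t • U₀ + Δ) x k|
      ≤ a * Real.sqrt h * (Real.sqrt h * r * euclNorm x + τ * euclNorm (U₀.mulVec x)) := by
  have hτ : 0 ≤ τ := (abs_nonneg _).trans ht
  have h1 := abs_reluNet_le (U := t • U₀ + Δ) (x := x) hV
    (ρ := fun j => r * euclNorm x + τ * |U₀ j ⬝ᵥ x|) (fun j => by
      have : (t • U₀ + Δ) j = t • U₀ j + Δ j := rfl
      rw [this, add_dotProduct, smul_dotProduct, smul_eq_mul, add_comm]
      refine (abs_add_le _ _).trans (add_le_add ((abs_dotProduct_le _ _).trans ?_) ?_)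
      · exact mul_le_mul_of_nonneg_right (hΔ j) (euclNorm_nonneg _)
      · rw [abs_mul]; exact mul_le_mul_of_nonneg_right ht (abs_nonneg _)) k
  rw [Finset.sum_add_distrib, ← Finset.mul_sum] at h1
  simp only [Finset.sum_const, Finset.card_univ, Fintype.card_fin, nsmul_eq_mul] at h1
  refine h1.trans ?_
  rw [mul_assoc]
  gcongr
  have h2 := mul_le_mul_of_nonneg_left (sum_abs_dotProduct_le U₀ x) hτ
  have h3 : Real.sqrt h * Real.sqrt h = h := Real.mul_self_sqrt (Nat.cast_nonneg h)
  have h4 : Real.sqrt h * (Real.sqrt h * r * euclNorm x) = h * (r * euclNorm x) := by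
    rw [mul_assoc, ← mul_assoc, h3]
  rw [mul_add, h4, ← Finset.mul_sum]
  linarith

end Loss

/-! ### Exponential moments for finite classes of networks -/

section FiniteClass

variable {d c h m : ℕ} {F : Type*} [Fintype F] [Nonempty F]

/-- The normalization of `V` makes the mean of the maximum at most `16 + 8 * (∑ i, q i) / m`, and
the squared increments sum to at most `16 * (∑ i, q i) / m`. Half of the latter is added to the
former in the bounded differences inequality. -/
theorem signAvg_exp_clip_le (hc : 2 ≤ c) (hh : 0 < h) (hm : 0 < m) {γ w r τ : ℝ} (hγ : 0 < γ)
    (hw : 0 < w) (U₀ : Matrix (Fin h) (Fin d) ℝ)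
    (V : F → Matrix (Fin c) (Fin h) ℝ) (Δ : F → Matrix (Fin h) (Fin d) ℝ) (t : F → ℝ)
    (hV : ∀ f j, euclNorm ((V f).transpose j) ≤ w * γ / Real.sqrt (c * h * m))
    (hΔ : ∀ f j, euclNorm (Δ f j) ≤ r) (ht : ∀ f, |t f| ≤ τ)
    (x : Fin m → Fin d → ℝ) (y : Fin m → Fin c) :
    signAvg (fun b => Real.exp (maxVal b)) 0 (List.ofFn fun i => (2 : ℝ) • fun f =>
        clip γ (margin (reluNet (V f) (t f • U₀ + Δ f) (x i)) (y i)) / w)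
      ≤ Real.exp (16 + 16 * (∑ i, (h * r ^ 2 * euclNorm (x i) ^ 2
          + τ ^ 2 * euclNorm (U₀.mulVec (x i)) ^ 2)) / m) := by
  set a := w * γ / Real.sqrt (c * h * m) with ha
  have hc0 : (0 : ℝ) < c := by positivity
  have hh0 : (0 : ℝ) < h := by positivity
  have hm0 : (0 : ℝ) < m := by positivity
  have ha0 : 0 < a := by positivity
  have hr0 : 0 ≤ r := (euclNorm_nonneg _).trans (hΔ (Classical.arbitrary F) ⟨0, hh⟩)
  have hτ0 : 0 ≤ τ := (abs_nonneg _).trans (ht (Classical.arbitrary F))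
  set q : Fin m → ℝ := fun i => h * r ^ 2 * euclNorm (x i) ^ 2
    + τ ^ 2 * euclNorm (U₀.mulVec (x i)) ^ 2 with hq
  set ψ : Fin m → F → ℝ := fun i => (2 : ℝ) • fun f =>
    clip γ (margin (reluNet (V f) (t f • U₀ + Δ f) (x i)) (y i)) / w with hψ
  set P := Real.sqrt (∑ i, euclNorm (x i) ^ 2) with hP
  set T := Real.sqrt (∑ i, euclNorm (U₀.mulVec (x i)) ^ 2) with hT
  have hsplit : Real.sqrt (c * h * m) = Real.sqrt c * Real.sqrt h * Real.sqrt m := by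
    rw [Real.sqrt_mul (by positivity), Real.sqrt_mul (by positivity)]
  have hsc : 0 < Real.sqrt c := Real.sqrt_pos.2 hc0
  have hsh : 0 < Real.sqrt h := Real.sqrt_pos.2 hh0
  have hsm : 0 < Real.sqrt m := Real.sqrt_pos.2 hm0
  have hsc2 : Real.sqrt c ^ 2 = c := Real.sq_sqrt hc0.le
  have hsh2 : Real.sqrt h ^ 2 = h := Real.sq_sqrt hh0.le
  have hsm2 : Real.sqrt m ^ 2 = m := Real.sq_sqrt hm0.le
  -- The 4 combines the doubling from symmetrization with the Lipschitz constant 2 of the margin.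
  have hrad := signAvg_reluNet_le x ψ V Δ t U₀ (κ := 4 / (γ * w)) (by positivity) ha0.le hV hΔ ht
    (fun i f f' => by
      obtain ⟨k, hk⟩ := exists_abs_margin_sub_le hc (reluNet (V f) (t f • U₀ + Δ f) (x i))
        (reluNet (V f') (t f' • U₀ + Δ f') (x i)) (y i)
      refine ⟨k, ?_⟩
      have h1 := abs_clip_sub_clip_le hγ
        (margin (reluNet (V f) (t f • U₀ + Δ f) (x i)) (y i))
        (margin (reluNet (V f') (t f' • U₀ + Δ f') (x i)) (y i))
      simp only [hψ, Pi.smul_apply, smul_eq_mul]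
      rw [← mul_sub, ← sub_div, abs_mul, abs_div, abs_of_pos hw, abs_two]
      calc _ ≤ 2 * ((2 * |reluNet (V f) (t f • U₀ + Δ f) (x i) k
            - reluNet (V f') (t f' • U₀ + Δ f') (x i) k|) / γ / w) := by
            gcongr
            exact h1.trans (by gcongr)
        _ = _ := by field_simp; ring)
  have hz : 4 * (4 / (γ * w)) * a * Real.sqrt c * (h * r * P + Real.sqrt h * τ * T)
      = 16 * ((Real.sqrt h * r * P + τ * T) / Real.sqrt m) := by
    have e : (h : ℝ) * r * P + Real.sqrt h * τ * T
        = Real.sqrt h * (Real.sqrt h * r * P + τ * T) := by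
      rw [mul_add, ← mul_assoc, ← mul_assoc, ← sq, hsh2]; ring
    rw [e, ha, hsplit]
    field_simp
    ring
  have hPT : (Real.sqrt h * r * P) ^ 2 + (τ * T) ^ 2 = ∑ i, q i := by
    rw [mul_pow, mul_pow, mul_pow, hsh2, hP, hT, Real.sq_sqrt (by positivity),
      Real.sq_sqrt (by positivity), hq, Finset.sum_add_distrib, Finset.mul_sum, Finset.mul_sum]
  have hz2 : ((Real.sqrt h * r * P + τ * T) / Real.sqrt m) ^ 2 ≤ 2 * (∑ i, q i) / m := by
    rw [div_pow, hsm2, ← hPT]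
    gcongr
    nlinarith [sq_nonneg (Real.sqrt h * r * P - τ * T)]
  have hrad2 : signAvg maxVal 0 (List.ofFn ψ) ≤ 16 + 8 * (∑ i, q i) / m := by
    rw [hz] at hrad
    have e : 8 * (∑ i, q i) / m = 4 * (2 * (∑ i, q i) / m) := by ring
    rw [e]
    -- With `z` the quotient, this is `16 z ≤ 16 + 4 z ^ 2`.
    nlinarith [sq_nonneg ((Real.sqrt h * r * P + τ * T) / Real.sqrt m - 2)]
  have hnorm : ∀ i, ‖ψ i‖ ^ 2 ≤ 16 * q i / m := fun i => by
    set A := Real.sqrt h * r * euclNorm (x i) with hA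
    set B := τ * euclNorm (U₀.mulVec (x i)) with hB
    have hA0 : 0 ≤ A := by have := euclNorm_nonneg (x i); positivity
    have hB0 : 0 ≤ B := by have := euclNorm_nonneg (U₀.mulVec (x i)); positivity
    have h1 : ‖ψ i‖ ≤ 4 / (Real.sqrt c * Real.sqrt m) * (A + B) := by
      refine (pi_norm_le_iff_of_nonneg (by positivity)).2 fun f => ?_
      obtain ⟨k, hk⟩ := exists_abs_margin_sub_le hc (reluNet (V f) (t f • U₀ + Δ f) (x i)) 0 (y i)
      have h2 := abs_clip_sub_clip_le hγ
        (margin (reluNet (V f) (t f • U₀ + Δ f) (x i)) (y i)) 0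
      rw [margin_zero] at hk
      rw [clip_zero] at h2
      simp only [sub_zero, Pi.zero_apply] at hk h2
      have h3 := abs_reluNet_add_le (U₀ := U₀) ha0.le (hV f) (hΔ f) (ht f) (x i) k
      simp only [hψ, Pi.smul_apply, smul_eq_mul, Real.norm_eq_abs]
      rw [abs_mul, abs_div, abs_of_pos hw, abs_two]
      calc _ ≤ 2 * ((2 * (a * Real.sqrt h * (A + B))) / γ / w) := by
            gcongr
            exact h2.trans (by gcongr; exact hk.trans (by gcongr))
        _ = _ := by
            rw [ha, hsplit]
            field_simp
            ring
    calc _ ≤ (4 / (Real.sqrt c * Real.sqrt m) * (A + B)) ^ 2 := by gcongr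
      _ = 16 * ((A + B) ^ 2 / c) / m := by
          rw [mul_pow, div_pow, mul_pow, hsc2, hsm2]
          field_simp
          ring
      _ ≤ _ := by
          gcongr
          rw [div_le_iff₀ hc0]
          have h4 : A ^ 2 + B ^ 2 = q i := by
            rw [hA, hB, mul_pow, mul_pow, mul_pow, hsh2]
          -- The factor 2 in `(A + B) ^ 2 ≤ 2 * (A ^ 2 + B ^ 2)` is absorbed by the division by `c`.
          have h5 : (2 : ℝ) ≤ c := by exact_mod_cast hc
          rw [← h4]
          nlinarith [sq_nonneg (A - B), sq_nonneg A, sq_nonneg B]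
  refine (signAvg_exp_maxVal_le 0 (List.ofFn ψ)).trans (Real.exp_le_exp.2 ?_)
  have hsum : ((List.ofFn ψ).map fun x => ‖x‖ ^ 2).sum ≤ 16 * (∑ i, q i) / m := by
    rw [List.map_ofFn, List.sum_ofFn, Finset.mul_sum, Finset.sum_div]
    exact Finset.sum_le_sum fun i _ => hnorm i
  have e1 : 16 * (∑ i, q i) / m = 8 * (∑ i, q i) / m + 8 * (∑ i, q i) / m := by ring
  rw [e1] at hsum ⊢
  linarith

/-- Tail bound for the centred empirical process of a finite class of networks evaluated at
transformed inputs. -/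
theorem measure_maxVal_clip_gt_le (hc : 2 ≤ c) (hh : 0 < h) (hm : 0 < m) {γ w r τ : ℝ}
    (hγ : 0 < γ) (hw : 0 < w) (D : Measure ((Fin d → ℝ) × Fin c)) [IsProbabilityMeasure D]
    (U₀ : Matrix (Fin h) (Fin d) ℝ) {T : (Fin d → ℝ) → Fin d → ℝ} (hT : Measurable T)
    (hq1 : ∀ x, 16 * (h * r ^ 2 * euclNorm (T x) ^ 2
      + τ ^ 2 * euclNorm (U₀.mulVec (T x)) ^ 2) / m ≤ 1)
    (hq2 : ∫ z, (h * r ^ 2 * euclNorm (T z.1) ^ 2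
      + τ ^ 2 * euclNorm (U₀.mulVec (T z.1)) ^ 2) ∂D ≤ 2)
    (V : F → Matrix (Fin c) (Fin h) ℝ) (Δ : F → Matrix (Fin h) (Fin d) ℝ) (t : F → ℝ)
    (hV : ∀ f j, euclNorm ((V f).transpose j) ≤ w * γ / Real.sqrt (c * h * m))
    (hΔ : ∀ f j, euclNorm (Δ f j) ≤ r) (ht : ∀ f, |t f| ≤ τ) {ε : ℝ} (hε : 0 < ε) :
    Measure.pi (fun _ : Fin m => D) {S | ∃ f, w * (80 + Real.log (1 / ε))
        < ∑ i, clip γ (margin (reluNet (V f) (t f • U₀ + Δ f) (T (S i).1)) (S i).2)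
          - m * ∫ z, clip γ (margin (reluNet (V f) (t f • U₀ + Δ f) (T z.1)) z.2) ∂D}
      ≤ ENNReal.ofReal ε := by
  set X : (Fin d → ℝ) × Fin c → F → ℝ := fun z f =>
    clip γ (margin (reluNet (V f) (t f • U₀ + Δ f) (T z.1)) z.2) / w with hX
  set q : (Fin d → ℝ) × Fin c → ℝ := fun z => h * r ^ 2 * euclNorm (T z.1) ^ 2
      + τ ^ 2 * euclNorm (U₀.mulVec (T z.1)) ^ 2 with hqdef
  have hm0 : (0 : ℝ) < m := by positivity
  have hXm : Measurable X := by
    refine measurable_pi_lambda _ fun f => ?_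
    exact ((continuous_clip γ).measurable.comp (measurable_margin_comp hc
      ((measurable_reluNet _ _).comp hT))).div_const w
  have hmax : Measurable (maxVal : (F → ℝ) → ℝ) := measurable_maxVal
  have hB : ∀ z f, |X z f| ≤ 1 / w := fun z f => by
    rw [hX, abs_of_nonneg (div_nonneg (clip_nonneg _ _) hw.le)]
    exact div_le_div_of_nonneg_right (clip_le_one _ _) hw.le
  have hqm : Measurable q := by
    have h1 : Measurable (euclNorm : (Fin d → ℝ) → ℝ) := continuous_euclNorm.measurable
    have h2 : Measurable fun x : Fin d → ℝ => euclNorm (U₀.mulVec x) :=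
      (continuous_euclNorm.comp (Continuous.matrix_mulVec continuous_const
        continuous_id)).measurable
    have h3 : Measurable fun z : (Fin d → ℝ) × Fin c => T z.1 := hT.comp measurable_fst
    exact (((h1.comp h3).pow_const 2).const_mul _).add (((h2.comp h3).pow_const 2).const_mul _)
  have hq0 : ∀ z, 0 ≤ q z := fun z => by positivity
  have hq1' : ∀ z, 16 * q z / m ≤ 1 := fun z => hq1 z.1
  have hint : Integrable q D := Integrable.of_bound hqm.aestronglyMeasurable (m / 16)
    (Filter.Eventually.of_forall fun z => by
      have := hq1' z
      rw [div_le_one hm0] at this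
      rw [Real.norm_eq_abs, abs_of_nonneg (hq0 z)]
      linarith)
  -- On `[0, 1]` one has `exp y ≤ 1 + 2 y`, and `q` has mean at most 2, so each sample point
  -- contributes `64 / m`. Together with the 16 from the sign average this gives 80.
  have hstep : ∫⁻ S, ENNReal.ofReal (Real.exp (∑ i, 16 * q (S i) / m))
      ∂Measure.pi (fun _ : Fin m => D) ≤ ENNReal.ofReal (Real.exp (m * (64 / m))) := by
    refine lintegral_exp_sum_le D m (Y := fun z => 16 * q z / m) (by fun_prop)
      (lintegral_exp_le_of_forall_le D ((hint.const_mul 32).div_const m) (fun z => ?_) ?_)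
    · have h1 := hq1' z
      have h2 : 0 ≤ 16 * q z / m := by have := hq0 z; positivity
      have h3 := (abs_le.1 (Real.abs_exp_sub_one_sub_id_le (x := 16 * q z / m)
        (by rw [abs_of_nonneg h2]; exact h1))).2
      have h4 : 32 * q z / m = 16 * q z / m + 16 * q z / m := by ring
      rw [h4]
      nlinarith
    · rw [integral_div, integral_const_mul]
      gcongr
      linarith
  have hlint : ∫⁻ S, ENNReal.ofReal (Real.exp (maxVal (0 + ∑ i, (X (S i)
      - fun f => ∫ z, X z f ∂D)))) ∂Measure.pi (fun _ : Fin m => D)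
      ≤ ENNReal.ofReal (Real.exp 80) := by
    refine (lintegral_exp_maxVal_sum_le D m hXm hB 0).trans ?_
    calc _ ≤ ∫⁻ S, ENNReal.ofReal (Real.exp 16)
          * ENNReal.ofReal (Real.exp (∑ i, 16 * q (S i) / m))
          ∂Measure.pi (fun _ : Fin m => D) := by
          refine lintegral_mono fun S => ?_
          rw [← ENNReal.ofReal_mul (Real.exp_pos _).le, ← Real.exp_add]
          refine ENNReal.ofReal_le_ofReal ?_
          refine (signAvg_exp_clip_le hc hh hm hγ hw U₀ V Δ t hV hΔ ht (fun i => T (S i).1)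
            (fun i => (S i).2)).trans (le_of_eq ?_)
          rw [← Finset.sum_div, ← Finset.mul_sum]
      _ ≤ ENNReal.ofReal (Real.exp 16) * ENNReal.ofReal (Real.exp (m * (64 / m))) := by
          rw [lintegral_const_mul' _ _ ENNReal.ofReal_ne_top]
          gcongr
      _ = _ := by
          rw [← ENNReal.ofReal_mul (Real.exp_pos _).le, ← Real.exp_add,
            mul_div_cancel₀ _ hm0.ne']
          norm_num
  refine (measure_mono fun S hS => ?_).trans
    (measure_gt_le_of_lintegral_exp_le _ (by fun_prop) hε hlint)
  obtain ⟨f, hf⟩ := hS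
  rw [Set.mem_ofPred_eq]
  refine lt_of_lt_of_le ?_ (le_maxVal _ f)
  simp only [zero_add, Finset.sum_apply, Pi.sub_apply, Finset.sum_sub_distrib, hX,
    integral_div, Finset.sum_const, Finset.card_univ, Fintype.card_fin, nsmul_eq_mul,
    Pi.mul_apply, Pi.natCast_apply]
  rw [← Finset.sum_div, ← mul_div_assoc, ← sub_div, lt_div_iff₀ hw, mul_comm]
  exact hf

end FiniteClass

/-! ### From finite classes to all bounded weights -/

section AllNetworks

variable {d c h m : ℕ}

/-- Tail bound for the centred empirical process of all networks whose weights are suitably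
bounded, evaluated at transformed inputs. -/
theorem measure_exists_clip_gt_le (hc : 2 ≤ c) (hh : 0 < h) (hm : 0 < m) {γ w r τ : ℝ}
    (hγ : 0 < γ) (hw : 0 < w) (hr : 0 ≤ r) (hτ : 0 ≤ τ)
    (D : Measure ((Fin d → ℝ) × Fin c)) [IsProbabilityMeasure D]
    (U₀ : Matrix (Fin h) (Fin d) ℝ) {T : (Fin d → ℝ) → Fin d → ℝ} (hT : Measurable T)
    (hq1 : ∀ x, 16 * (h * r ^ 2 * euclNorm (T x) ^ 2
      + τ ^ 2 * euclNorm (U₀.mulVec (T x)) ^ 2) / m ≤ 1)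
    (hq2 : ∫ z, (h * r ^ 2 * euclNorm (T z.1) ^ 2
      + τ ^ 2 * euclNorm (U₀.mulVec (T z.1)) ^ 2) ∂D ≤ 2) {ε : ℝ} (hε : 0 < ε) :
    Measure.pi (fun _ : Fin m => D) {S | ∃ (V : Matrix (Fin c) (Fin h) ℝ)
        (Δ : Matrix (Fin h) (Fin d) ℝ) (t : ℝ),
        (∀ j, euclNorm (V.transpose j) ≤ w * γ / Real.sqrt (c * h * m)) ∧
        (∀ j, euclNorm (Δ j) ≤ r) ∧ |t| ≤ τ ∧ w * (80 + Real.log (1 / ε))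
        < ∑ i, clip γ (margin (reluNet V (t • U₀ + Δ) (T (S i).1)) (S i).2)
          - m * ∫ z, clip γ (margin (reluNet V (t • U₀ + Δ) (T z.1)) z.2) ∂D}
      ≤ ENNReal.ofReal ε := by
  have : SecondCountableTopology (Matrix (Fin c) (Fin h) ℝ) :=
    inferInstanceAs (SecondCountableTopology (Fin c → Fin h → ℝ))
  have : SecondCountableTopology (Matrix (Fin h) (Fin d) ℝ) :=
    inferInstanceAs (SecondCountableTopology (Fin h → Fin d → ℝ))
  set Θ : Set (Matrix (Fin c) (Fin h) ℝ × Matrix (Fin h) (Fin d) ℝ × ℝ) := {θ | (∀ j, euclNorm (θ.1.transpose j)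
      ≤ w * γ / Real.sqrt (c * h * m)) ∧ (∀ j, euclNorm (θ.2.1 j) ≤ r) ∧ |θ.2.2| ≤ τ} with hΘ
  have he0 : ∀ n, euclNorm (0 : Fin n → ℝ) = 0 := fun n => by simp [euclNorm]
  have hne : Nonempty Θ := ⟨⟨0, fun j => (he0 c).trans_le (by positivity),
    fun j => (he0 d).trans_le hr, by simpa using hτ⟩⟩
  let φ : Matrix (Fin c) (Fin h) ℝ × Matrix (Fin h) (Fin d) ℝ × ℝ →
      (Fin d → ℝ) × Fin c → ℝ := fun θ z => 
    clip γ (margin (reluNet θ.1 (θ.2.2 • U₀ + θ.2.1) (T z.1)) z.2)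
  have hφc : ∀ z, Continuous fun θ => φ θ z := fun z => by
    refine (continuous_clip γ).comp ((continuous_margin hc z.2).comp ?_)
    refine continuous_pi fun k => ?_
    have : ∀ θ : Matrix (Fin c) (Fin h) ℝ × Matrix (Fin h) (Fin d) ℝ × ℝ,
        reluNet θ.1 (θ.2.2 • U₀ + θ.2.1) (T z.1) k
        = ∑ j, θ.1 k j * max (∑ l, (θ.2.2 * U₀ j l + θ.2.1 j l) * T z.1 l) 0 := fun θ => rfl
    simp only [this]
    fun_prop
  have hφm : ∀ θ, Measurable (φ θ) := fun θ => (continuous_clip γ).measurable.comp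
    (measurable_margin_comp hc ((measurable_reluNet _ _).comp hT))
  have hic : Continuous fun θ => ∫ z, φ θ z ∂D := by
    refine continuous_of_dominated (bound := fun _ => 1)
      (fun θ => (hφm θ).aestronglyMeasurable) (fun θ => Filter.Eventually.of_forall fun z => ?_)
      (integrable_const _) (Filter.Eventually.of_forall hφc)
    rw [Real.norm_eq_abs, abs_of_nonneg (clip_nonneg _ _)]
    exact clip_le_one _ _
  set G : Matrix (Fin c) (Fin h) ℝ × Matrix (Fin h) (Fin d) ℝ × ℝ →
      (Fin m → (Fin d → ℝ) × Fin c) → ℝ := fun θ S =>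
    ∑ i, φ θ (S i) - m * ∫ z, φ θ z ∂D with hG
  have hGc : ∀ S, Continuous fun θ : Θ => G θ S := fun S =>
    ((continuous_finsetSum _ fun i _ => hφc (S i)).sub (hic.const_mul _)).comp
      continuous_subtype_val
  set b := w * (80 + Real.log (1 / ε)) with hb
  -- The excess is continuous in the weights, so if it is exceeded anywhere it is exceeded at a
  -- point of a dense sequence. The events for initial segments increase, and their common bound
  -- does not depend on the number of networks.
  let u : ℕ → Θ := TopologicalSpace.denseSeq Θ
  have hu : DenseRange u := TopologicalSpace.denseRange_denseSeq Θ
  let A : ℕ → Set (Fin m → (Fin d → ℝ) × Fin c) := fun N => {S | ∃ n : Fin (N + 1), b < G (u n) S}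
  have hA : Monotone A := fun N N' hNN S hS => by
    obtain ⟨n, hn⟩ := hS
    exact ⟨⟨n, by omega⟩, hn⟩
  have hAN : ∀ N, Measure.pi (fun _ : Fin m => D) (A N) ≤ ENNReal.ofReal ε := fun N =>
    measure_maxVal_clip_gt_le hc hh hm hγ hw D U₀ hT hq1 hq2
      (fun n : Fin (N + 1) => (u n).1.1) (fun n => (u n).1.2.1) (fun n => (u n).1.2.2)
      (fun n => (u n).2.1) (fun n => (u n).2.2.1) (fun n => (u n).2.2.2) hε
  refine (measure_mono fun S hS => ?_).trans ((hA.measure_iUnion).trans_le (iSup_le hAN))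
  obtain ⟨V, Δ, t, hV, hΔ, ht, hlt⟩ := hS
  have hopen : IsOpen {θ : Θ | b < G θ S} := isOpen_lt continuous_const (hGc S)
  obtain ⟨n, hn⟩ := hu.exists_mem_open hopen ⟨⟨(V, Δ, t), hV, hΔ, ht⟩, hlt⟩
  exact Set.mem_iUnion.2 ⟨n, ⟨⟨n, by omega⟩, hn⟩⟩

end AllNetworks

/-! ### Network size and normalization of the weights -/

section Sample

variable {d c h m : ℕ}

/-- The complexity term for networks with columns of `V` of norm at most `α` and rows of `U - U₀`
of norm at most `β`, on inputs with root sums of squares `P` and `Q` before and after `U₀`. -/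
noncomputable def netSize (c h : ℕ) (γ α β P Q : ℝ) : ℝ :=
  Real.sqrt c * Real.sqrt h * α * (Real.sqrt h * β * P + Q) / γ

/-- The root of the sum of squared Euclidean norms. -/
noncomputable def rootSumSq {m n : ℕ} (x : Fin m → Fin n → ℝ) : ℝ :=
  Real.sqrt (∑ i, euclNorm (x i) ^ 2)

theorem euclNorm_le_rootSumSq {m n : ℕ} (x : Fin m → Fin n → ℝ) (i : Fin m) :
    euclNorm (x i) ≤ rootSumSq x := by
  apply Real.le_sqrt_of_sq_le
  exact Finset.single_le_sum (f := fun i => euclNorm (x i) ^ 2) (fun i _ => sq_nonneg _)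
    (Finset.mem_univ i)

/-- A sample is good if the sum of the clipped margins of every network of size at least one half
exceeds its expectation by at most `K` times the size. -/
def IsGoodSample (D : Measure ((Fin d → ℝ) × Fin c)) (γ K : ℝ) (U₀ : Matrix (Fin h) (Fin d) ℝ)
    (S : Fin m → (Fin d → ℝ) × Fin c) : Prop :=
  ∀ (V : Matrix (Fin c) (Fin h) ℝ) (U : Matrix (Fin h) (Fin d) ℝ) (α β : ℝ),
    (∀ j, euclNorm (V.transpose j) ≤ α) → (∀ j, euclNorm ((U - U₀) j) ≤ β) →
    1 / 2 ≤ netSize c h γ α β (rootSumSq fun i => (S i).1)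
      (rootSumSq fun i => U₀.mulVec (S i).1) →
    ∑ i, clip γ (margin (reluNet V U (S i).1) (S i).2)
      ≤ m * ∫ z, clip γ (margin (reluNet V U z.1) z.2) ∂D
        + K * netSize c h γ α β (rootSumSq fun i => (S i).1)
          (rootSumSq fun i => U₀.mulVec (S i).1)

/-- By positive homogeneity of the ReLU, dividing the hidden weights by `B = √h β s₁ + s₂` and
multiplying `V` by `B` does not change the network. The bounds on `Δ` and `t` no longer depend on
the network, so only the scale of the output weights remains to be discretized. -/
theorem exists_scaled_weights {T : (Fin d → ℝ) → Fin d → ℝ} {U₀ : Matrix (Fin h) (Fin d) ℝ}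
    (V : Matrix (Fin c) (Fin h) ℝ) (U : Matrix (Fin h) (Fin d) ℝ) {α β s₁ s₂ : ℝ} (hh : 0 < h)
    (hβ0 : 0 ≤ β) (hs₁ : 0 ≤ s₁) (hs₂ : 0 ≤ s₂) (hT₁ : s₁ = 0 → ∀ x, T x = 0)
    (hT₂ : s₂ = 0 → ∀ x, U₀.mulVec (T x) = 0)
    (hα : ∀ j, euclNorm (V.transpose j) ≤ α) (hβ : ∀ j, euclNorm ((U - U₀) j) ≤ β) :
    ∃ (V' : Matrix (Fin c) (Fin h) ℝ) (Δ : Matrix (Fin h) (Fin d) ℝ) (t : ℝ),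
      (∀ j, euclNorm (V'.transpose j) ≤ α * (Real.sqrt h * β * s₁ + s₂)) ∧
      (∀ j, euclNorm (Δ j) ≤ (Real.sqrt h * s₁)⁻¹) ∧ |t| ≤ s₂⁻¹ ∧
      ∀ x, reluNet V' (t • U₀ + Δ) (T x) = reluNet V U (T x) := by
  have hsh : 0 < Real.sqrt h := Real.sqrt_pos.2 (by positivity)
  set B := Real.sqrt h * β * s₁ + s₂ with hB
  have hB0 : 0 ≤ B := by positivity
  have hsmul : ∀ {n : ℕ} (b : ℝ) (v : Fin n → ℝ), 0 ≤ b → euclNorm (b • v) = b * euclNorm v := by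
    intro n b v hb
    simp [euclNorm, norm_smul, abs_of_nonneg hb]
  have hz : ∀ n, euclNorm (0 : Fin n → ℝ) = 0 := fun n => by simp [euclNorm]
  -- A vanishing scale has inverse zero, which forces the corresponding hidden weight to be zero.
  -- This is harmless because truncation then annihilates that part of the input.
  refine ⟨B • V, if s₁ = 0 then 0 else B⁻¹ • (U - U₀), if s₂ = 0 then 0 else B⁻¹, ?_, ?_, ?_, ?_⟩
  · intro j
    have : (B • V).transpose j = B • V.transpose j := rfl
    rw [this, hsmul _ _ hB0, mul_comm]
    gcongr
    exact hα j
  · intro j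
    split_ifs with h0
    · exact (hz d).trans_le (by positivity)
    · have hs₁' : 0 < s₁ := lt_of_le_of_ne hs₁ (Ne.symm h0)
      have : (B⁻¹ • (U - U₀)) j = B⁻¹ • (U - U₀) j := rfl
      rw [this, hsmul _ _ (inv_nonneg.2 hB0)]
      rcases hB0.eq_or_lt with hB' | hB'
      · rw [← hB', inv_zero, zero_mul]; positivity
      · rw [inv_mul_le_iff₀ hB', ← div_eq_mul_inv, le_div_iff₀ (by positivity)]
        have := mul_le_mul_of_nonneg_right (hβ j) (by positivity : 0 ≤ Real.sqrt h * s₁)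
        refine this.trans ?_
        rw [hB]
        linarith [mul_comm β (Real.sqrt h * s₁), mul_right_comm (Real.sqrt h) s₁ β]
  · split_ifs with h0
    · simpa using hs₂
    · have hs₂' : 0 < s₂ := lt_of_le_of_ne hs₂ (Ne.symm h0)
      rw [abs_of_nonneg (inv_nonneg.2 hB0)]
      exact inv_anti₀ hs₂' (by rw [hB]; linarith [show 0 ≤ Real.sqrt h * β * s₁ by positivity])
  · intro x
    by_cases h1 : s₁ = 0
    · rw [hT₁ h1 x, reluNet_zero, reluNet_zero]
    have hs₁' : 0 < s₁ := lt_of_le_of_ne hs₁ (Ne.symm h1)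
    have hdot : ∀ j, U₀ j ⬝ᵥ T x = U₀.mulVec (T x) j := fun j => rfl
    have hdec : ∀ j, U j ⬝ᵥ T x = U₀ j ⬝ᵥ T x + (U - U₀) j ⬝ᵥ T x := fun j => by
      have : (U - U₀) j = U j - U₀ j := rfl
      rw [this, sub_dotProduct]; ring
    have hrow : ∀ j, ((if s₂ = 0 then 0 else B⁻¹) • U₀ + B⁻¹ • (U - U₀)) j ⬝ᵥ T x
        = B⁻¹ * (U j ⬝ᵥ T x) := fun j => by
      have e : ((if s₂ = 0 then 0 else B⁻¹) • U₀ + B⁻¹ • (U - U₀)) j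
        = (if s₂ = 0 then 0 else B⁻¹) • U₀ j + B⁻¹ • (U - U₀) j := rfl
      rw [e, add_dotProduct, smul_dotProduct, smul_dotProduct, smul_eq_mul, smul_eq_mul, hdec j]
      split_ifs with h2
      · rw [hdot, hT₂ h2 x]; simp
      · ring
    ext k
    rw [if_neg h1, reluNet_apply, reluNet_apply]
    refine Finset.sum_congr rfl fun j _ => ?_
    rw [hrow j]
    have hV' : (B • V) k j = B * V k j := rfl
    rw [hV']
    -- If `B = 0`, the new output weights vanish. Then `s₂ = 0` and `β = 0`, so the original
    -- preactivations vanish on truncated inputs too.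
    rcases hB0.eq_or_lt with hB' | hB'
    · have hb1 : 0 ≤ Real.sqrt h * β * s₁ := by positivity
      have hs₂0 : s₂ = 0 := by linarith
      have hβz : β = 0 := by
        have : Real.sqrt h * β * s₁ = 0 := by linarith
        rcases mul_eq_zero.1 this with h3 | h3
        · exact (mul_eq_zero.1 h3).resolve_left hsh.ne'
        · exact absurd h3 h1
      have : U j ⬝ᵥ T x = 0 := by
        rw [hdec j, hdot, hT₂ hs₂0 x]
        have h4 := abs_dotProduct_le ((U - U₀) j) (T x)
        have h5 : euclNorm ((U - U₀) j) = 0 :=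
          le_antisymm ((hβ j).trans_eq hβz) (euclNorm_nonneg _)
        rw [h5, zero_mul] at h4
        simpa using h4
      rw [this]; simp
    · rw [← mul_zero B⁻¹, ← mul_max_of_nonneg _ _ (inv_nonneg.2 hB0), mul_zero]
      field_simp

end Sample

/-! ### Truncated inputs and the good event -/

section Sample

variable {d c h m : ℕ}

/-- A truncation of the inputs that controls both the inputs and their images under `U₀`. -/
theorem exists_input_truncation (D : Measure ((Fin d → ℝ) × Fin c)) [IsProbabilityMeasure D]
    (U₀ : Matrix (Fin h) (Fin d) ℝ) {η : ℝ} (hη0 : 0 < η) :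
    ∃ (N : Set (Fin d → ℝ)) (s₁ s₂ : ℝ), MeasurableSet N ∧ 0 ≤ s₁ ∧ 0 ≤ s₂ ∧
      D.real {z | z.1 ∉ N} ≤ 2 * η ∧
      (s₁ = 0 → ∀ x, N.indicator id x = 0) ∧
      (s₂ = 0 → ∀ x, U₀.mulVec (N.indicator id x) = 0) ∧
      (∀ x, (s₁ ^ 2)⁻¹ * euclNorm (N.indicator id x) ^ 2
        + (s₂ ^ 2)⁻¹ * euclNorm (U₀.mulVec (N.indicator id x)) ^ 2 ≤ 8 / η) ∧
      (∫ z, ((s₁ ^ 2)⁻¹ * euclNorm (N.indicator id z.1) ^ 2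
        + (s₂ ^ 2)⁻¹ * euclNorm (U₀.mulVec (N.indicator id z.1)) ^ 2) ∂D ≤ 2) ∧
      ∀ (n : ℕ) (ε : ℝ), 0 < ε → 16 * Real.log (1 / ε) ≤ n * η →
        Measure.pi (fun _ : Fin n => D) {S | ∑ i, euclNorm (S i).1 ^ 2 < n * s₁ ^ 2 / 4}
          ≤ ENNReal.ofReal ε ∧
        Measure.pi (fun _ : Fin n => D)
          {S | ∑ i, euclNorm (U₀.mulVec (S i).1) ^ 2 < n * s₂ ^ 2 / 4} ≤ ENNReal.ofReal ε := by
  set g₁ : (Fin d → ℝ) × Fin c → ℝ := fun z => euclNorm z.1 with hg₁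
  set g₂ : (Fin d → ℝ) × Fin c → ℝ := fun z => euclNorm (U₀.mulVec z.1) with hg₂
  have hx₁ : Measurable (euclNorm : (Fin d → ℝ) → ℝ) := continuous_euclNorm.measurable
  have hx₂ : Measurable fun x : Fin d → ℝ => euclNorm (U₀.mulVec x) :=
    (continuous_euclNorm.comp (Continuous.matrix_mulVec continuous_const
      continuous_id)).measurable
  have hm₁ : Measurable g₁ := hx₁.comp measurable_fst
  have hm₂ : Measurable g₂ := hx₂.comp measurable_fst
  have hp₁ : ∀ z, 0 ≤ g₁ z := fun z => euclNorm_nonneg _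
  have hp₂ : ∀ z, 0 ≤ g₂ z := fun z => euclNorm_nonneg _
  obtain ⟨R₁, hR₁, hA₁, hS₁⟩ := exists_truncation_level D hm₁ hp₁ hη0
  obtain ⟨R₂, hR₂, hA₂, hS₂⟩ := exists_truncation_level D hm₂ hp₂ hη0
  have b₁ := fun n ε hε => measure_sum_sq_lt_le D hm₁ hp₁ hR₁ hS₁ n (ε := ε) hε
  have b₂ := fun n ε hε => measure_sum_sq_lt_le D hm₂ hp₂ hR₂ hS₂ n (ε := ε) hε
  set v₁ := ∫ z, (min (g₁ z) R₁) ^ 2 ∂D with hv₁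
  set v₂ := ∫ z, (min (g₂ z) R₂) ^ 2 ∂D with hv₂
  have hv₁0 : 0 ≤ v₁ := integral_nonneg fun z => sq_nonneg _
  have hv₂0 : 0 ≤ v₂ := integral_nonneg fun z => sq_nonneg _
  set s₁ := Real.sqrt v₁ with hs₁
  set s₂ := Real.sqrt v₂ with hs₂
  have hs₁0 : 0 ≤ s₁ := Real.sqrt_nonneg _
  have hs₂0 : 0 ≤ s₂ := Real.sqrt_nonneg _
  have hs₁2 : s₁ ^ 2 = v₁ := Real.sq_sqrt hv₁0
  have hs₂2 : s₂ ^ 2 = v₂ := Real.sq_sqrt hv₂0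
  -- A single set truncates both norms, so a truncated input is either unchanged or zero.
  set N : Set (Fin d → ℝ) := {x | euclNorm x ≤ R₁} ∩ {x | euclNorm (U₀.mulVec x) ≤ R₂} with hN
  have hNm : MeasurableSet N := (measurableSet_le hx₁ measurable_const).inter
    (measurableSet_le hx₂ measurable_const)
  set T : (Fin d → ℝ) → Fin d → ℝ := N.indicator id with hT
  have hTm : Measurable T := measurable_id.indicator hNm
  have hTin : ∀ x ∈ N, T x = x := fun x hx => Set.indicator_of_mem hx _
  have hTout : ∀ x ∉ N, T x = 0 := fun x hx => Set.indicator_of_notMem hx _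
  have he0 : ∀ n, euclNorm (0 : Fin n → ℝ) = 0 := fun n => by simp [euclNorm]
  have hT₁ : ∀ x, euclNorm (T x) ≤ min (euclNorm x) R₁ := fun x => by
    by_cases hx : x ∈ N
    · rw [hTin x hx]; exact le_min le_rfl hx.1
    · rw [hTout x hx, he0]; exact le_min (euclNorm_nonneg _) hR₁
  have hT₂ : ∀ x, euclNorm (U₀.mulVec (T x)) ≤ min (euclNorm (U₀.mulVec x)) R₂ := fun x => by
    by_cases hx : x ∈ N
    · rw [hTin x hx]; exact le_min le_rfl hx.2
    · rw [hTout x hx, Matrix.mulVec_zero, he0]; exact le_min (euclNorm_nonneg _) hR₂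
  have hzero : ∀ {n : ℕ} {v : Fin n → ℝ}, euclNorm v ≤ 0 → v = 0 := by
    intro n v hv
    have : ‖WithLp.toLp 2 v‖ = 0 := le_antisymm hv (norm_nonneg _)
    simpa using this
  have hRz : ∀ {R v : ℝ}, 0 ≤ R → R ^ 2 * η ≤ 4 * v → v = 0 → R = 0 := by
    intro R v hR hRv hv
    rw [hv, mul_zero] at hRv
    by_contra hne
    have : 0 < R ^ 2 * η := by positivity
    linarith
  have hz₁ : s₁ = 0 → ∀ x, T x = 0 := fun h0 x => by
    have := hRz hR₁ hS₁ (by rw [← hs₁2, h0]; norm_num)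
    exact hzero ((hT₁ x).trans ((min_le_right _ _).trans this.le))
  have hz₂ : s₂ = 0 → ∀ x, U₀.mulVec (T x) = 0 := fun h0 x => by
    have := hRz hR₂ hS₂ (by rw [← hs₂2, h0]; norm_num)
    exact hzero ((hT₂ x).trans ((min_le_right _ _).trans this.le))
  have hlev : ∀ {R v y : ℝ}, 0 ≤ v → 0 ≤ y → R ^ 2 * η ≤ 4 * v → y ≤ R → v⁻¹ * y ^ 2 ≤ 4 / η := by
    intro R v y hv hy hRv hyR
    rcases hv.eq_or_lt with h0 | h0
    · rw [← h0]; simp; positivity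
    · rw [inv_mul_le_iff₀ h0, mul_div_assoc', le_div_iff₀ hη0]
      have : y ^ 2 * η ≤ R ^ 2 * η := by gcongr
      linarith
  have hA : D.real {z : (Fin d → ℝ) × Fin c | z.1 ∉ N} ≤ 2 * η := by
    have hsub : {z : (Fin d → ℝ) × Fin c | z.1 ∉ N} ⊆ {z | R₁ < g₁ z} ∪ {z | R₂ < g₂ z} := by
      intro z hz
      by_contra hcon
      rw [Set.mem_union, not_or] at hcon
      have q₁ : euclNorm z.1 ≤ R₁ := not_lt.1 hcon.1
      have q₂ : euclNorm (U₀.mulVec z.1) ≤ R₂ := not_lt.1 hcon.2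
      exact hz ⟨q₁, q₂⟩
    have := (measureReal_mono hsub).trans (measureReal_union_le (μ := D) _ _)
    linarith
  have hi : ∀ {g : (Fin d → ℝ) × Fin c → ℝ} {R : ℝ}, Measurable g → (∀ z, 0 ≤ g z) → 0 ≤ R →
      Integrable (fun z => (min (g z) R) ^ 2) D := by
    intro g R hg hg0 hR
    refine Integrable.of_bound (by fun_prop) (R ^ 2) (Filter.Eventually.of_forall fun z => ?_)
    rw [Real.norm_eq_abs, abs_of_nonneg (sq_nonneg _)]
    exact pow_le_pow_left₀ (le_min (hg0 z) hR) (min_le_right _ _) 2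

  refine ⟨N, s₁, s₂, hNm, hs₁0, hs₂0, hA, hz₁, hz₂, fun x => ?_, ?_, fun n ε hε hn => ?_⟩
  · rw [hs₁2, hs₂2]
    have h1 := hlev hv₁0 (euclNorm_nonneg _) hS₁ ((hT₁ x).trans (min_le_right _ _))
    have h2 := hlev hv₂0 (euclNorm_nonneg _) hS₂ ((hT₂ x).trans (min_le_right _ _))
    have h3 : 8 / η = 4 / η + 4 / η := by ring
    rw [h3]
    exact add_le_add h1 h2
  · rw [hs₁2, hs₂2]
    have hnn : ∀ z : (Fin d → ℝ) × Fin c, 0 ≤ v₁⁻¹ * euclNorm (T z.1) ^ 2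
        + v₂⁻¹ * euclNorm (U₀.mulVec (T z.1)) ^ 2 := fun z =>
      add_nonneg (mul_nonneg (inv_nonneg.2 hv₁0) (sq_nonneg _))
        (mul_nonneg (inv_nonneg.2 hv₂0) (sq_nonneg _))
    have hle : ∀ z : (Fin d → ℝ) × Fin c, v₁⁻¹ * euclNorm (T z.1) ^ 2
        + v₂⁻¹ * euclNorm (U₀.mulVec (T z.1)) ^ 2
        ≤ v₁⁻¹ * (min (g₁ z) R₁) ^ 2 + v₂⁻¹ * (min (g₂ z) R₂) ^ 2 := fun z =>
      add_le_add
        (mul_le_mul_of_nonneg_left (pow_le_pow_left₀ (euclNorm_nonneg _) (hT₁ z.1) 2)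
          (inv_nonneg.2 hv₁0))
        (mul_le_mul_of_nonneg_left (pow_le_pow_left₀ (euclNorm_nonneg _) (hT₂ z.1) 2)
          (inv_nonneg.2 hv₂0))
    have i₁ : Integrable (fun z => v₁⁻¹ * (min (g₁ z) R₁) ^ 2) D := (hi hm₁ hp₁ hR₁).const_mul _
    have i₂ : Integrable (fun z => v₂⁻¹ * (min (g₂ z) R₂) ^ 2) D := (hi hm₂ hp₂ hR₂).const_mul _
    calc ∫ z, (v₁⁻¹ * euclNorm (T z.1) ^ 2 + v₂⁻¹ * euclNorm (U₀.mulVec (T z.1)) ^ 2) ∂D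
        ≤ ∫ z, (v₁⁻¹ * (min (g₁ z) R₁) ^ 2 + v₂⁻¹ * (min (g₂ z) R₂) ^ 2) ∂D :=
          integral_mono_of_nonneg (Filter.Eventually.of_forall hnn) (i₁.add i₂)
            (Filter.Eventually.of_forall hle)
      _ = v₁⁻¹ * v₁ + v₂⁻¹ * v₂ := by
          rw [integral_add i₁ i₂, integral_const_mul, integral_const_mul]
      -- Only an inequality holds, since a vanishing second moment has inverse zero.
      _ ≤ 1 + 1 := add_le_add inv_mul_le_one inv_mul_le_one
      _ = 2 := by norm_num
  · rw [hs₁2, hs₂2]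
    exact ⟨b₁ n ε hε hn, b₂ n ε hε hn⟩

/-- Comparison of empirical and expected clipped margins outside the exceptional events. -/
theorem sum_clip_le (hc : 2 ≤ c) (hh : 0 < h) (hm : 0 < m) {γ : ℝ} (hγ : 0 < γ)
    (D : Measure ((Fin d → ℝ) × Fin c)) [IsProbabilityMeasure D]
    (U₀ : Matrix (Fin h) (Fin d) ℝ) {l : ℝ} (hl0 : 0 ≤ l) {N : Set (Fin d → ℝ)}
    (hN : MeasurableSet N) {s₁ s₂ : ℝ} (hs₁0 : 0 ≤ s₁) (hs₂0 : 0 ≤ s₂)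
    (hz₁ : s₁ = 0 → ∀ x, N.indicator id x = 0)
    (hz₂ : s₂ = 0 → ∀ x, U₀.mulVec (N.indicator id x) = 0)
    {S : Fin m → (Fin d → ℝ) × Fin c} (h₁ : m * s₁ ^ 2 / 4 ≤ ∑ i, euclNorm (S i).1 ^ 2)
    (h₂ : m * s₂ ^ 2 / 4 ≤ ∑ i, euclNorm (U₀.mulVec (S i).1) ^ 2)
    (h₃ : ∑ i, Set.indicator {z : (Fin d → ℝ) × Fin c | z.1 ∉ N} (fun _ => (1 : ℝ)) (S i)
      ≤ 512 + 65 * l)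
    (h₄ : ∀ w < 2 * m, ∀ (V : Matrix (Fin c) (Fin h) ℝ) (Δ : Matrix (Fin h) (Fin d) ℝ) (t : ℝ),
        (∀ j, euclNorm (V.transpose j) ≤ (w + 1 : ℕ) * γ / Real.sqrt (c * h * m)) →
        (∀ j, euclNorm (Δ j) ≤ (Real.sqrt h * s₁)⁻¹) → |t| ≤ s₂⁻¹ →
        ∑ i, clip γ (margin (reluNet V (t • U₀ + Δ) (N.indicator id (S i).1)) (S i).2)
          - m * ∫ z, clip γ (margin (reluNet V (t • U₀ + Δ) (N.indicator id z.1)) z.2) ∂D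
        ≤ (w + 1 : ℕ) * (80 + l)) :
    IsGoodSample D γ (1344 + 134 * l) U₀ S := by
  intro V U α β hα hβ
  set P := rootSumSq fun i => (S i).1 with hP
  set Q := rootSumSq fun i => U₀.mulVec (S i).1 with hQ
  set W := netSize c h γ α β P Q with hW
  intro hW2
  have hm0 : (0 : ℝ) < m := by positivity
  have hc0 : (0 : ℝ) < c := by positivity
  have hh0 : (0 : ℝ) < h := by positivity
  have hα0 : 0 ≤ α := (euclNorm_nonneg _).trans (hα ⟨0, hh⟩)
  have hβ0 : 0 ≤ β := (euclNorm_nonneg _).trans (hβ ⟨0, hh⟩)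
  have hcm : ∀ {T : (Fin d → ℝ) → Fin d → ℝ}, Measurable T →
      Integrable (fun z => clip γ (margin (reluNet V U (T z.1)) z.2)) D := by
    intro T hT
    refine Integrable.of_bound ((continuous_clip γ).measurable.comp (measurable_margin_comp hc
      ((measurable_reluNet V U).comp hT))).aestronglyMeasurable 1
      (Filter.Eventually.of_forall fun z => ?_)
    rw [Real.norm_eq_abs, abs_of_nonneg (clip_nonneg _ _)]
    exact clip_le_one _ _
  have htot : ∑ i, clip γ (margin (reluNet V U (S i).1) (S i).2) ≤ m := by
    refine (Finset.sum_le_sum fun i _ => clip_le_one _ _).trans ?_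
    simp
  have hint0 : 0 ≤ ∫ z, clip γ (margin (reluNet V U z.1) z.2) ∂D :=
    integral_nonneg fun z => clip_nonneg _ _
  -- Each clipped margin is at most one, so nothing is to be shown when `m ≤ W`.
  rcases le_or_gt (m : ℝ) W with hWm | hWm
  · have : W ≤ (1344 + 134 * l) * W := le_mul_of_one_le_left (by linarith) (by linarith)
    have := mul_nonneg hm0.le hint0
    linarith
  -- The scale is `2 * W` rounded up, the 2 coming from `√m s₁ ≤ 2 P` and `√m s₂ ≤ 2 Q`. Since `W ≥
  -- 1 / 2`, rounding gives at most `4 * W`, and `W < m` leaves at most `2 * m` scales.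
  have hwpos : 0 < ⌈2 * W⌉₊ := Nat.ceil_pos.2 (by linarith)
  obtain ⟨w, hw⟩ : ∃ w, ⌈2 * W⌉₊ = w + 1 := ⟨_, (Nat.succ_pred_eq_of_pos hwpos).symm⟩
  have hwm : w < 2 * m := by
    have : ⌈2 * W⌉₊ ≤ 2 * m := Nat.ceil_le.2 (by push_cast; linarith)
    omega
  have hw1 : 2 * W ≤ (w + 1 : ℕ) := hw ▸ Nat.le_ceil _
  have hw2 : ((w + 1 : ℕ) : ℝ) ≤ 4 * W := by
    have := Nat.ceil_lt_add_one (show 0 ≤ 2 * W by linarith)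
    rw [hw] at this
    linarith
  obtain ⟨V', Δ, t, hV', hΔ, ht, hnet⟩ := exists_scaled_weights V U hh hβ0 hs₁0 hs₂0 hz₁ hz₂ hα hβ
  have hroot : ∀ {s q : ℝ}, 0 ≤ s → m * s ^ 2 / 4 ≤ q → Real.sqrt m * s ≤ 2 * Real.sqrt q := by
    intro s q hs hsq
    have h5 : Real.sqrt (m * s ^ 2 / 4) = Real.sqrt m * s / 2 := by
      rw [Real.sqrt_div' _ (by norm_num), Real.sqrt_mul hm0.le, Real.sqrt_sq hs]
      congr 1
      rw [show (4 : ℝ) = 2 ^ 2 by norm_num, Real.sqrt_sq (by norm_num)]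
    have := Real.sqrt_le_sqrt hsq
    linarith
  have hr₁ : Real.sqrt m * s₁ ≤ 2 * P := hroot hs₁0 h₁
  have hr₂ : Real.sqrt m * s₂ ≤ 2 * Q := hroot hs₂0 h₂
  have hVw : ∀ j, euclNorm (V'.transpose j) ≤ (w + 1 : ℕ) * γ / Real.sqrt (c * h * m) := fun j => by
    refine (hV' j).trans ?_
    rw [le_div_iff₀ (by positivity), Real.sqrt_mul (by positivity), Real.sqrt_mul (by positivity)]
    calc _ = Real.sqrt c * Real.sqrt h * α * (Real.sqrt h * β * (Real.sqrt m * s₁)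
          + Real.sqrt m * s₂) := by ring
      _ ≤ Real.sqrt c * Real.sqrt h * α * (Real.sqrt h * β * (2 * P) + 2 * Q) := by gcongr
      _ = 2 * W * γ := by
          rw [hW, netSize]
          field_simp
      _ ≤ _ := by gcongr
  have h5 := h₄ w hwm V' Δ t hVw hΔ ht
  simp only [hnet] at h5
  have h6 : ∑ i, clip γ (margin (reluNet V U (S i).1) (S i).2)
      ≤ ∑ i, clip γ (margin (reluNet V U (N.indicator id (S i).1)) (S i).2)
        + ∑ i, Set.indicator {z : (Fin d → ℝ) × Fin c | z.1 ∉ N} (fun _ => (1 : ℝ)) (S i) := by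
    rw [← Finset.sum_add_distrib]
    refine Finset.sum_le_sum fun i _ => ?_
    by_cases hx : (S i).1 ∈ N
    · rw [Set.indicator_of_mem hx, Set.indicator_of_notMem (by simpa using hx)]
      simp
    · rw [Set.indicator_of_mem (a := S i) (s := {z : (Fin d → ℝ) × Fin c | z.1 ∉ N}) hx]
      linarith [clip_le_one γ (margin (reluNet V U (S i).1) (S i).2),
        clip_nonneg γ (margin (reluNet V U (N.indicator id (S i).1)) (S i).2)]
  -- At a truncated input the network, its margin and its clipped margin are zero, so truncation can
  -- only decrease the expectation.
  have h7 : ∫ z, clip γ (margin (reluNet V U (N.indicator id z.1)) z.2) ∂D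
      ≤ ∫ z, clip γ (margin (reluNet V U z.1) z.2) ∂D := by
    have i₁ := hcm (T := N.indicator id) (measurable_id.indicator hN)
    have i₂ := hcm (T := fun x => x) measurable_id
    refine integral_mono i₁ i₂ fun z => ?_
    by_cases hx : z.1 ∈ N
    · simp [Set.indicator_of_mem hx]
    · simp only [Set.indicator_of_notMem hx, reluNet_zero, margin_zero, clip_zero]
      exact clip_nonneg _ _
  have h8 := mul_le_mul_of_nonneg_left h7 hm0.le
  -- The two contributions `4 * W * (80 + l)` and `2 * W * (512 + 65 * l)` add up to `(1344 + 134 *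
  -- l) * W`.
  have h9 : ((w + 1 : ℕ) : ℝ) * (80 + l) ≤ 4 * W * (80 + l) := by gcongr
  have h10 : 512 + 65 * l ≤ (2 * W) * (512 + 65 * l) :=
    le_mul_of_one_le_left (by positivity) (by linarith)
  linarith

/-- Two second moment events, one counting event and `2 * m` scales each cost `ε`, and `3 + 2 * m ≤
5 * m`. -/
theorem measure_not_isGoodSample_le (hc : 2 ≤ c) (hh : 0 < h) (hm : 0 < m) {γ : ℝ} (hγ : 0 < γ)
    (D : Measure ((Fin d → ℝ) × Fin c)) [IsProbabilityMeasure D]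
    (U₀ : Matrix (Fin h) (Fin d) ℝ) {ε : ℝ} (hε : 0 < ε) (hε1 : ε ≤ 1) :
    Measure.pi (fun _ : Fin m => D)
      {S | ¬ IsGoodSample D γ (1344 + 134 * Real.log (1 / ε)) U₀ S}
      ≤ ENNReal.ofReal (5 * m * ε) := by
  have hm0 : (0 : ℝ) < m := by positivity
  have hm1 : (1 : ℝ) ≤ m := by exact_mod_cast hm
  have hh0 : (0 : ℝ) < h := by positivity
  have hsh : 0 < Real.sqrt h := Real.sqrt_pos.2 hh0
  have hsh2 : Real.sqrt h ^ 2 = h := Real.sq_sqrt hh0.le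
  set l := Real.log (1 / ε) with hl
  have hl0 : 0 ≤ l := Real.log_nonneg (by rw [le_div_iff₀ hε]; linarith)
  -- The term 128 makes `16 * (8 / η) ≤ m`, the boundedness needed for the exponential moment. The
  -- term `16 * l` is what the lower tail of the second moments requires.
  set L := 128 + 16 * l with hL
  set η := L / m with hη
  have hL0 : 0 < L := by positivity
  have hη0 : 0 < η := by positivity
  have hmη : m * η = L := by rw [hη]; field_simp
  obtain ⟨N, s₁, s₂, hNm, hs₁0, hs₂0, hA, hz₁, hz₂, hq1, hq2, htail⟩ :=
    exists_input_truncation D U₀ hη0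
  obtain ⟨b₁, b₂⟩ := htail m ε hε (by rw [hmη]; linarith)
  set T : (Fin d → ℝ) → Fin d → ℝ := N.indicator id with hT
  have hTm : Measurable T := measurable_id.indicator hNm
  set r := (Real.sqrt h * s₁)⁻¹ with hr
  set τ := s₂⁻¹ with hτ
  have hr2 : h * r ^ 2 = (s₁ ^ 2)⁻¹ := by
    rw [hr, inv_pow, mul_pow, hsh2, mul_inv, ← mul_assoc, mul_inv_cancel₀ hh0.ne', one_mul]
  have hτ2 : τ ^ 2 = (s₂ ^ 2)⁻¹ := inv_pow _ _
  rw [← hr2, ← hτ2] at hq2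
  simp only [← hr2, ← hτ2] at hq1
  have hq1' : ∀ x, 16 * (h * r ^ 2 * euclNorm (T x) ^ 2
      + τ ^ 2 * euclNorm (U₀.mulVec (T x)) ^ 2) / m ≤ 1 := fun x => by
    rw [div_le_one hm0]
    have h3 : 16 * (8 / η) ≤ m := by
      rw [mul_div_assoc', div_le_iff₀ hη0, hmη, hL]
      linarith
    linarith [hq1 x]
  have hAm : MeasurableSet {z : (Fin d → ℝ) × Fin c | z.1 ∉ N} :=
    hNm.compl.preimage measurable_fst
  have b₃ := measure_count_gt_le D hAm hA m hε
  have b₄ : ∀ w : ℕ, 0 < w → _ := fun w hw => measure_exists_clip_gt_le hc hh hm (w := w) hγ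
    (by positivity) (r := r) (τ := τ) (by positivity) (by positivity) D U₀ hTm hq1' hq2 hε
  set E₁ := {S : Fin m → (Fin d → ℝ) × Fin c | ∑ i, euclNorm (S i).1 ^ 2 < m * s₁ ^ 2 / 4}
  set E₂ := {S : Fin m → (Fin d → ℝ) × Fin c |
    ∑ i, euclNorm (U₀.mulVec (S i).1) ^ 2 < m * s₂ ^ 2 / 4}
  set E₃ := {S : Fin m → (Fin d → ℝ) × Fin c | m * (2 * (2 * η)) + Real.log (1 / ε)
    < ∑ i, Set.indicator {z : (Fin d → ℝ) × Fin c | z.1 ∉ N} (fun _ => (1 : ℝ)) (S i)} with hE₃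
  set E₄ : ℕ → Set (Fin m → (Fin d → ℝ) × Fin c) := fun w =>
    {S | ∃ (V : Matrix (Fin c) (Fin h) ℝ)
        (Δ : Matrix (Fin h) (Fin d) ℝ) (t : ℝ),
        (∀ j, euclNorm (V.transpose j) ≤ (w + 1 : ℕ) * γ / Real.sqrt (c * h * m)) ∧
        (∀ j, euclNorm (Δ j) ≤ r) ∧ |t| ≤ τ ∧ (w + 1 : ℕ) * (80 + Real.log (1 / ε))
        < ∑ i, clip γ (margin (reluNet V (t • U₀ + Δ) (T (S i).1)) (S i).2)
          - m * ∫ z, clip γ (margin (reluNet V (t • U₀ + Δ) (T z.1)) z.2) ∂D} with hE₄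
  have hsub : {S : Fin m → (Fin d → ℝ) × Fin c |
      ¬ IsGoodSample D γ (1344 + 134 * Real.log (1 / ε)) U₀ S}
      ⊆ E₁ ∪ E₂ ∪ E₃ ∪ ⋃ w ∈ Finset.range (2 * m), E₄ w := by
    intro S hS
    by_contra hcon
    simp only [Set.mem_union, Set.mem_iUnion, not_or, not_exists] at hcon
    obtain ⟨⟨⟨n₁, n₂⟩, n₃⟩, n₄⟩ := hcon
    refine hS (sum_clip_le hc hh hm hγ D U₀ hl0 hNm hs₁0 hs₂0 hz₁ hz₂ (not_lt.1 n₁) (not_lt.1 n₂)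
      ((not_lt.1 n₃).trans (le_of_eq ?_)) fun w hw V Δ t hV hΔ ht => ?_)
    -- The truncated set has mass at most `2 * η`, so its count is bounded by `4 * L + l = 512 + 65
    -- * l`.
    · rw [show (m : ℝ) * (2 * (2 * η)) = 4 * (m * η) by ring, hmη, hL]
      ring
    · by_contra! hlt
      exact n₄ w (Finset.mem_range.2 hw) ⟨V, Δ, t, hV, hΔ, ht, hlt⟩
  refine (measure_mono hsub).trans ?_
  refine (measure_union_le _ _).trans ((add_le_add ((measure_union_le _ _).trans (add_le_add
    ((measure_union_le _ _).trans (add_le_add b₁ b₂)) b₃)) ((measure_biUnion_finset_le _ _).trans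
    (Finset.sum_le_sum fun w _ => b₄ (w + 1) (by omega)))).trans ?_)
  rw [Finset.sum_const, Finset.card_range, nsmul_eq_mul, ← ENNReal.ofReal_add hε.le hε.le,
    ← ENNReal.ofReal_add (by positivity) hε.le, ← ENNReal.ofReal_natCast,
    ← ENNReal.ofReal_mul (by positivity), ← ENNReal.ofReal_add (by positivity) (by positivity)]
  apply ENNReal.ofReal_le_ofReal
  push_cast
  nlinarith

end Sample

/-! ### Small networks, norm comparison and constants -/

section Final

variable {d c h m : ℕ}

theorem netSize_nonneg {γ α β P Q : ℝ} (hγ : 0 < γ) (hα : 0 ≤ α) (hβ : 0 ≤ β) (hP : 0 ≤ P)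
    (hQ : 0 ≤ Q) : 0 ≤ netSize c h γ α β P Q := by
  unfold netSize; positivity

theorem netSize_mul (b γ α β P Q : ℝ) :
    netSize c h γ (b * α) β P Q = b * netSize c h γ α β P Q := by
  unfold netSize; ring

theorem abs_margin_reluNet_le (hc : 2 ≤ c) {γ α β : ℝ} (hγ : 0 < γ)
    {V : Matrix (Fin c) (Fin h) ℝ} {U U₀ : Matrix (Fin h) (Fin d) ℝ} (hα0 : 0 ≤ α) (hβ0 : 0 ≤ β)
    (hα : ∀ j, euclNorm (V.transpose j) ≤ α) (hβ : ∀ j, euclNorm ((U - U₀) j) ≤ β)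
    (x : Fin m → Fin d → ℝ) (i : Fin m) (y : Fin c) :
    |margin (reluNet V U (x i)) y|
      ≤ 2 * (γ * netSize c h γ α β (rootSumSq x) (rootSumSq fun i => U₀.mulVec (x i))) := by
  obtain ⟨k, hk⟩ := exists_abs_margin_sub_le hc (reluNet V U (x i)) 0 y
  rw [margin_zero] at hk
  simp only [sub_zero, Pi.zero_apply] at hk
  refine hk.trans ?_
  have h1 := abs_reluNet_add_le (U₀ := U₀) (t := 1) (τ := 1) hα0 hα hβ (by simp) (x i) k
  rw [one_smul, add_sub_cancel] at h1
  have h2 := euclNorm_le_rootSumSq x i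
  have h3 := euclNorm_le_rootSumSq (fun i => U₀.mulVec (x i)) i
  have h4 : (1 : ℝ) ≤ Real.sqrt c := by
    rw [Real.one_le_sqrt]; exact_mod_cast (by omega : 1 ≤ c)
  have hP : 0 ≤ rootSumSq x := Real.sqrt_nonneg _
  have hQ : 0 ≤ rootSumSq fun i => U₀.mulVec (x i) := Real.sqrt_nonneg _
  have h5 : γ * netSize c h γ α β (rootSumSq x) (rootSumSq fun i => U₀.mulVec (x i))
      = Real.sqrt c * (α * Real.sqrt h * (Real.sqrt h * β * rootSumSq x
        + rootSumSq fun i => U₀.mulVec (x i))) := by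
    unfold netSize; field_simp
  rw [h5]
  gcongr
  refine h1.trans ?_
  rw [one_mul]
  refine le_trans ?_ (le_mul_of_one_le_left (by positivity) h4)
  gcongr

/-- Below size one half an additive error would be too large compared with the size. Since margins
are at most `2 * γ` times the size, such a network is `b = 2 * W` times one of size one half whose
margins are at most `γ`. The sum of clipped margins scales exactly by `b`, and the classification
error is unchanged. -/
theorem IsGoodSample.sum_clip_le (hc : 2 ≤ c) (hh : 0 < h) {γ K : ℝ} (hγ : 0 < γ)
    {D : Measure ((Fin d → ℝ) × Fin c)} [IsProbabilityMeasure D]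
    {U₀ : Matrix (Fin h) (Fin d) ℝ} {S : Fin m → (Fin d → ℝ) × Fin c}
    (hS : IsGoodSample D γ K U₀ S) (V : Matrix (Fin c) (Fin h) ℝ) (U : Matrix (Fin h) (Fin d) ℝ)
    {α β : ℝ} (hα : ∀ j, euclNorm (V.transpose j) ≤ α) (hβ : ∀ j, euclNorm ((U - U₀) j) ≤ β) :
    ∑ i, clip γ (margin (reluNet V U (S i).1) (S i).2)
      ≤ m * (1 - expectedLoss D 0 (reluNet V U))
        + K * netSize c h γ α β (rootSumSq fun i => (S i).1)
          (rootSumSq fun i => U₀.mulVec (S i).1) := by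
  have hα0 : 0 ≤ α := (euclNorm_nonneg _).trans (hα ⟨0, hh⟩)
  have hβ0 : 0 ≤ β := (euclNorm_nonneg _).trans (hβ ⟨0, hh⟩)
  set P := rootSumSq fun i => (S i).1 with hP
  set Q := rootSumSq fun i => U₀.mulVec (S i).1 with hQ
  have hP0 : 0 ≤ P := Real.sqrt_nonneg _
  have hQ0 : 0 ≤ Q := Real.sqrt_nonneg _
  have hramp : ∀ t, 0 ≤ ramp 0 t ∧ ramp 0 t ≤ 1 := fun t => by
    rw [ramp_zero]; split_ifs <;> norm_num
  have hrm : Measurable (ramp 0) := by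
    have : ramp 0 = fun t => if t ≤ 0 then (1 : ℝ) else 0 := funext ramp_zero
    rw [this]
    exact Measurable.ite measurableSet_Iic measurable_const measurable_const
  have hmarg : ∀ V : Matrix (Fin c) (Fin h) ℝ,
      Measurable fun z : (Fin d → ℝ) × Fin c => margin (reluNet V U z.1) z.2 := fun V =>
    measurable_margin_comp hc (measurable_reluNet V U)
  have hloss : ∀ V : Matrix (Fin c) (Fin h) ℝ,
      ∫ z, clip γ (margin (reluNet V U z.1) z.2) ∂D ≤ 1 - expectedLoss D 0 (reluNet V U) := by
    intro V
    have i₁ : Integrable (fun z : (Fin d → ℝ) × Fin c => ramp 0 (margin (reluNet V U z.1) z.2)) D :=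
      Integrable.of_bound (hrm.comp (hmarg V)).aestronglyMeasurable 1
        (Filter.Eventually.of_forall fun z => by
          rw [Real.norm_eq_abs, abs_of_nonneg (hramp _).1]; exact (hramp _).2)
    have i₂ : Integrable (fun z : (Fin d → ℝ) × Fin c =>
        clip γ (margin (reluNet V U z.1) z.2)) D :=
      Integrable.of_bound ((continuous_clip γ).measurable.comp (hmarg V)).aestronglyMeasurable 1
        (Filter.Eventually.of_forall fun z => by
          rw [Real.norm_eq_abs, abs_of_nonneg (clip_nonneg _ _)]; exact clip_le_one _ _)
    have h1 := integral_mono i₂ ((integrable_const (1 : ℝ)).sub i₁)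
      fun z => clip_le_one_sub_ramp_zero hγ (margin (reluNet V U z.1) z.2)
    refine h1.trans (le_of_eq ?_)
    have h2 := integral_sub (integrable_const (1 : ℝ)) i₁
    simp only [integral_const, probReal_univ, one_smul] at h2
    exact h2
  have hloss1 : expectedLoss D 0 (reluNet V U) ≤ 1 := by
    have := (integral_nonneg fun z => clip_nonneg γ (margin (reluNet V U z.1) z.2)).trans (hloss V)
    linarith
  have hm0 : (0 : ℝ) ≤ m := Nat.cast_nonneg m
  set W := netSize c h γ α β P Q with hW
  have hW0 : 0 ≤ W := netSize_nonneg hγ hα0 hβ0 hP0 hQ0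
  rcases le_or_gt (1 / 2) W with hbig | hsmall
  · have h1 := hS V U α β hα hβ hbig
    have h2 := mul_le_mul_of_nonneg_left (hloss V) hm0
    linarith
  -- Size zero cannot be rescaled, but then all sample margins vanish.
  rcases hW0.eq_or_lt with h0 | hpos
  · rw [← h0, mul_zero, add_zero]
    refine le_trans (Finset.sum_nonpos fun i _ => ?_)
      (mul_nonneg hm0 (sub_nonneg.2 hloss1))
    have h1 := abs_margin_reluNet_le hc hγ hα0 hβ0 hα hβ (fun i => (S i).1) i (S i).2
    rw [← hP, ← hQ, ← hW, ← h0, mul_zero, mul_zero] at h1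
    have h2 : margin (reluNet V U (S i).1) (S i).2 = 0 := by simpa using h1
    rw [h2, clip_zero]
  set b := 2 * W with hb
  have hb0 : 0 < b := by positivity
  have hb1 : b ≤ 1 := by linarith
  have hα' : ∀ j, euclNorm ((b⁻¹ • V).transpose j) ≤ b⁻¹ * α := fun j => by
    have h1 : (b⁻¹ • V).transpose j = b⁻¹ • V.transpose j := rfl
    have h2 : euclNorm (b⁻¹ • V.transpose j) = b⁻¹ * euclNorm (V.transpose j) := by
      simp only [euclNorm, WithLp.toLp_smul, norm_smul, norm_inv, Real.norm_eq_abs,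
        abs_of_pos hb0]
    rw [h1, h2]
    gcongr
    exact hα j
  have hW' : netSize c h γ (b⁻¹ * α) β P Q = 1 / 2 := by
    rw [netSize_mul, ← hW, hb]
    field_simp
  have hV : V = b • (b⁻¹ • V) := by rw [smul_smul, mul_inv_cancel₀ hb0.ne', one_smul]
  have hmV : ∀ x y, margin (reluNet V U x) y = b * margin (reluNet (b⁻¹ • V) U x) y := by
    intro x y
    rw [← margin_smul hb0.le, ← reluNet_smul, ← hV]
  have h1 := hS (b⁻¹ • V) U (b⁻¹ * α) β hα' hβ (by rw [← hP, ← hQ, hW'])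
  rw [← hP, ← hQ, hW'] at h1
  have h2 : ∑ i, clip γ (margin (reluNet V U (S i).1) (S i).2)
      = b * ∑ i, clip γ (margin (reluNet (b⁻¹ • V) U (S i).1) (S i).2) := by
    rw [Finset.mul_sum]
    refine Finset.sum_congr rfl fun i _ => ?_
    rw [hmV]
    refine clip_mul_of_le hγ hb0.le hb1 ((le_abs_self _).trans ?_)
    have h3 := abs_margin_reluNet_le hc hγ (by positivity) hβ0 hα' hβ (fun i => (S i).1) i (S i).2
    rw [← hP, ← hQ, hW'] at h3
    linarith
  have h3 : expectedLoss D 0 (reluNet (b⁻¹ • V) U) = expectedLoss D 0 (reluNet V U) := by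
    unfold expectedLoss
    congr 1
    ext z
    rw [hmV, ramp_zero, ramp_zero]
    simp only [← not_lt, mul_pos_iff_of_pos_left hb0]
  have h4 := hloss (b⁻¹ • V)
  rw [h3] at h4
  have h5 := mul_le_mul_of_nonneg_left h4 hm0
  have h6 := mul_nonneg hm0 (sub_nonneg.2 hloss1)
  rw [h2]
  calc _ ≤ b * (m * (1 - expectedLoss D 0 (reluNet V U)) + K * (1 / 2)) := by
        gcongr
        linarith
    _ ≤ _ := by
        have h7 : b * (m * (1 - expectedLoss D 0 (reluNet V U)))
            ≤ m * (1 - expectedLoss D 0 (reluNet V U)) := mul_le_of_le_one_left h6 hb1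
        rw [mul_add, hb] at *
        linarith

theorem euclNorm_le_rowNorm {a b : ℕ} {p : ℝ} (hp : 0 < p) (A : Matrix (Fin a) (Fin b) ℝ)
    (j : Fin a) : euclNorm (A j) ≤ rowNorm p A := by
  have h1 : euclNorm (A j) ^ p ≤ ∑ i, euclNorm (A i) ^ p :=
    Finset.single_le_sum (f := fun i => euclNorm (A i) ^ p)
      (fun i _ => Real.rpow_nonneg (euclNorm_nonneg _) _) (Finset.mem_univ j)
  calc euclNorm (A j) = (euclNorm (A j) ^ p) ^ (1 / p) := by
        rw [← Real.rpow_mul (euclNorm_nonneg _), mul_one_div_cancel hp.ne', Real.rpow_one]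
    _ ≤ _ := Real.rpow_le_rpow (Real.rpow_nonneg (euclNorm_nonneg _) _) h1 (by positivity)

/-- The exponent `ln h` is chosen so that `h ^ (1 / ln h) = e`, a constant. -/
theorem rpow_half_sub_inv_log (hh : 2 ≤ h) :
    (h : ℝ) ^ (1 / 2 - 1 / Real.log h : ℝ) = Real.sqrt h / Real.exp 1 := by
  have h1 : (1 : ℝ) < h := by exact_mod_cast hh
  have h0 : (0 : ℝ) < h := by linarith
  rw [Real.rpow_sub h0, ← Real.sqrt_eq_rpow, Real.rpow_def_of_pos h0,
    mul_one_div_cancel (Real.log_pos h1).ne']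

theorem frobNorm_dataMatrix (S : Fin m → (Fin d → ℝ) × Fin c) :
    frobNorm (dataMatrix S) = rootSumSq fun i => (S i).1 := by
  unfold frobNorm rootSumSq
  rw [Finset.sum_comm]
  simp only [euclNorm_sq]
  rfl

theorem frobNorm_mul_dataMatrix (U₀ : Matrix (Fin h) (Fin d) ℝ)
    (S : Fin m → (Fin d → ℝ) × Fin c) :
    frobNorm (U₀ * dataMatrix S) = rootSumSq fun i => U₀.mulVec (S i).1 := by
  unfold frobNorm rootSumSq
  rw [Finset.sum_comm]
  simp only [euclNorm_sq]
  rfl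

theorem euclNorm_mulVec_le {a b : ℕ} (A : Matrix (Fin a) (Fin b) ℝ) (x : Fin b → ℝ) :
    euclNorm (A.mulVec x) ≤ specNorm A * euclNorm x := by
  have := (LinearMap.toContinuousLinearMap (Matrix.toLpLin 2 2 A)).le_opNorm (WithLp.toLp 2 x)
  simpa [euclNorm, specNorm] using this

theorem rootSumSq_mulVec_le (U₀ : Matrix (Fin h) (Fin d) ℝ) (x : Fin m → Fin d → ℝ) :
    (rootSumSq fun i => U₀.mulVec (x i)) ≤ specNorm U₀ * rootSumSq x := by
  have hs : 0 ≤ specNorm U₀ := norm_nonneg _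
  unfold rootSumSq
  rw [← Real.sqrt_sq hs, ← Real.sqrt_mul (sq_nonneg _), Finset.mul_sum]
  refine Real.sqrt_le_sqrt (Finset.sum_le_sum fun i _ => ?_)
  rw [← mul_pow]
  exact pow_le_pow_left₀ (euclNorm_nonneg _) (euclNorm_mulVec_le U₀ (x i)) 2

/-- The fourth power suffices because `5 ≤ 16 ≤ h ^ 4` and `m / δ ≥ 1`. -/
theorem log_five_mul_div_le {h m δ : ℝ} (hh : 2 ≤ h) (hm : 1 ≤ m) (hδ : 0 < δ) (hδ1 : δ < 1) :
    Real.log (5 * m / δ) ≤ 4 * Real.log (h * m / δ) := by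
  have h1 : 1 ≤ m / δ := by rw [le_div_iff₀ hδ]; linarith
  rw [show (4 : ℝ) * Real.log (h * m / δ) = Real.log ((h * m / δ) ^ 4) by
    rw [Real.log_pow]; norm_num]
  apply Real.log_le_log (by positivity)
  rw [mul_div_assoc, mul_div_assoc, mul_pow]
  have h2 : (16 : ℝ) ≤ h ^ 4 := by
    calc (16 : ℝ) = 2 ^ 4 := by norm_num
      _ ≤ _ := by gcongr
  have h3 : m / δ ≤ (m / δ) ^ 4 := le_self_pow₀ h1 (by norm_num)
  have h4 : 5 * (m / δ) ≤ 16 * (m / δ) ^ 4 := by linarith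
  exact h4.trans (by gcongr)

/-- The logarithm contributes `4 * 134 = 536`, and the remaining `1964 * log 2` exceeds 1344. -/
theorem const_le_log {h m δ : ℝ} (hh : 2 ≤ h) (hm : 1 ≤ m) (hδ : 0 < δ) (hδ1 : δ < 1) :
    1344 + 134 * Real.log (1 / (δ / (5 * m))) ≤ 2500 * Real.log (h * m / δ) := by
  have h1 := log_five_mul_div_le hh hm hδ hδ1
  have h2 : (2 : ℝ) ≤ h * m / δ := by
    rw [le_div_iff₀ hδ]
    nlinarith
  have h3 : Real.log 2 ≤ Real.log (h * m / δ) := Real.log_le_log (by norm_num) h2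
  have h4 := Real.log_two_gt_d9
  rw [one_div_div]
  linarith

/-- Each of the two factors `√h` costs a factor `e`, and `e ^ 2 ≤ 9`. -/
theorem netSize_le (hh : 2 ≤ h) {γ α β P Q : ℝ} (hγ : 0 < γ) (hα : 0 ≤ α) (hβ : 0 ≤ β)
    (hP : 0 ≤ P) (hQ : 0 ≤ Q) :
    netSize c h γ α β P Q ≤ 9 * (Real.sqrt c * (h : ℝ) ^ (1 / 2 - 1 / Real.log h : ℝ) * α
      * ((h : ℝ) ^ (1 / 2 - 1 / Real.log h : ℝ) * β * P + Q) / γ) := by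
  rw [rpow_half_sub_inv_log hh, netSize]
  set e := Real.exp 1 with he
  have he0 : 0 < e := Real.exp_pos 1
  have he3 : e ≤ 3 := Real.exp_one_lt_d9.le.trans (by norm_num)
  have he9 : e ^ 2 ≤ 9 := by nlinarith
  have h1 : Real.sqrt h * β * P + Q ≤ 9 / e * (Real.sqrt h / e * β * P + Q) := by
    have h2 : 1 ≤ 9 / e ^ 2 := by rw [le_div_iff₀ (by positivity)]; linarith
    have h3 : 1 ≤ 9 / e := by rw [le_div_iff₀ he0]; linarith
    have h4 : Real.sqrt h * β * P ≤ 9 / e ^ 2 * (Real.sqrt h * β * P) :=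
      le_mul_of_one_le_left (by positivity) h2
    have h5 : Q ≤ 9 / e * Q := le_mul_of_one_le_left hQ h3
    have h6 : 9 / e * (Real.sqrt h / e * β * P + Q)
        = 9 / e ^ 2 * (Real.sqrt h * β * P) + 9 / e * Q := by
      field_simp
    linarith
  calc _ ≤ Real.sqrt c * Real.sqrt h * α * (9 / e * (Real.sqrt h / e * β * P + Q)) / γ := by
        gcongr
    _ = _ := by field_simp

end Final

theorem mainTheorem6 :
    ∃ (C : ℝ) (k : ℕ), 0 < C ∧
      ∀ (d c h m : ℕ), 2 ≤ c → 2 ≤ h → 1 ≤ m →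
      ∀ (γ δ : ℝ), 0 < γ → 0 < δ → δ < 1 →
      ∀ (D : Measure ((Fin d → ℝ) × Fin c)), IsProbabilityMeasure D →
      ∀ (U₀ : Matrix (Fin h) (Fin d) ℝ),
        Measure.pi (fun _ : Fin m => D)
          {S | ¬ ∀ (V : Matrix (Fin c) (Fin h) ℝ) (U : Matrix (Fin h) (Fin d) ℝ),
            expectedLoss D 0 (reluNet V U) ≤ empiricalLoss S γ (reluNet V U)
              + C * Real.log (h * m / δ) ^ k *
                (Real.sqrt c * (h : ℝ) ^ (1 / 2 - 1 / Real.log h : ℝ)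
                  * rowNorm (Real.log h) V.transpose
                  * ((h : ℝ) ^ (1 / 2 - 1 / Real.log h : ℝ) * rowNorm (Real.log h) (U - U₀)
                      * frobNorm (dataMatrix S)
                    + frobNorm (U₀ * dataMatrix S)) / (γ * m)) ∧
            empiricalLoss S γ (reluNet V U)
              + C * Real.log (h * m / δ) ^ k *
                (Real.sqrt c * (h : ℝ) ^ (1 / 2 - 1 / Real.log h : ℝ)
                  * rowNorm (Real.log h) V.transpose
                  * ((h : ℝ) ^ (1 / 2 - 1 / Real.log h : ℝ) * rowNorm (Real.log h) (U - U₀)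
                      * frobNorm (dataMatrix S)
                    + frobNorm (U₀ * dataMatrix S)) / (γ * m))
              ≤ empiricalLoss S γ (reluNet V U)
              + C * Real.log (h * m / δ) ^ k *
                (Real.sqrt c * (h : ℝ) ^ (1 / 2 - 1 / Real.log h : ℝ)
                  * rowNorm (Real.log h) V.transpose
                  * ((h : ℝ) ^ (1 / 2 - 1 / Real.log h : ℝ) * rowNorm (Real.log h) (U - U₀)
                    + specNorm U₀)
                  * Real.sqrt ((1 / m : ℝ) * ∑ i, euclNorm (S i).1 ^ 2)
                  / (γ * Real.sqrt m))}
          ≤ ENNReal.ofReal δ := by 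
  -- The constant is `2500 * 9`, from `const_le_log` and `netSize_le`. A single logarithm suffices.
  refine ⟨22500, 1, by norm_num, ?_⟩
  intro d c h m hc hh hm γ δ hγ hδ hδ1 D hD U₀
  have hh1 : (1 : ℝ) < h := by exact_mod_cast hh
  have hh2 : (2 : ℝ) ≤ h := by exact_mod_cast hh
  have hm1 : (1 : ℝ) ≤ m := by exact_mod_cast hm
  have hm0 : (0 : ℝ) < m := by linarith
  have hp : 0 < Real.log h := Real.log_pos hh1
  have hε : 0 < δ / (5 * m) := by positivity
  have hε1 : δ / (5 * m) ≤ 1 := by rw [div_le_one (by positivity)]; linarith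
  -- Taking `ε = δ / (5 * m)` makes the total failure probability exactly `δ`.
  have hgood := measure_not_isGoodSample_le hc (by omega : 0 < h) hm hγ D U₀ hε hε1
  rw [show 5 * (m : ℝ) * (δ / (5 * m)) = δ by field_simp] at hgood
  refine (measure_mono fun S hS => ?_).trans hgood
  intro hgS
  apply hS
  intro V U
  simp only [frobNorm_dataMatrix, frobNorm_mul_dataMatrix, pow_one]
  set P := rootSumSq fun i => (S i).1 with hP
  set Q := rootSumSq fun i => U₀.mulVec (S i).1 with hQ
  set α := rowNorm (Real.log h) V.transpose with hα
  set β := rowNorm (Real.log h) (U - U₀) with hβ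
  set η := (h : ℝ) ^ (1 / 2 - 1 / Real.log h : ℝ) with hη
  set l := Real.log (h * m / δ) with hl
  have hP0 : 0 ≤ P := Real.sqrt_nonneg _
  have hQ0 : 0 ≤ Q := Real.sqrt_nonneg _
  have hη0 : 0 ≤ η := Real.rpow_nonneg (by positivity) _
  have hα' : ∀ j, euclNorm (V.transpose j) ≤ α := euclNorm_le_rowNorm hp V.transpose
  have hβ' : ∀ j, euclNorm ((U - U₀) j) ≤ β := euclNorm_le_rowNorm hp (U - U₀)
  have hα0 : 0 ≤ α := (euclNorm_nonneg _).trans (hα' ⟨0, by omega⟩)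
  have hβ0 : 0 ≤ β := (euclNorm_nonneg _).trans (hβ' ⟨0, by omega⟩)
  have hl0 : 0 ≤ l := Real.log_nonneg (by rw [le_div_iff₀ hδ]; nlinarith)
  constructor
  · have h1 := hgS.sum_clip_le hc (by omega) hγ V U hα' hβ'
    rw [← hP, ← hQ] at h1
    have h2 := netSize_le (c := c) hh hγ hα0 hβ0 hP0 hQ0
    have h3 := const_le_log hh2 hm1 hδ hδ1
    have hW0 : 0 ≤ netSize c h γ α β P Q := netSize_nonneg hγ hα0 hβ0 hP0 hQ0
    rw [← hη] at h2
    rw [← hl] at h3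
    set W₀ := Real.sqrt c * η * α * (η * β * P + Q) / γ with hW₀
    have h4 : (1344 + 134 * Real.log (1 / (δ / (5 * m)))) * netSize c h γ α β P Q
        ≤ 2500 * l * (9 * W₀) :=
      mul_le_mul h3 h2 hW0 (by positivity)
    have h5 : empiricalLoss S γ (reluNet V U)
        = 1 - (∑ i, clip γ (margin (reluNet V U (S i).1) (S i).2)) / m := by
      unfold empiricalLoss
      simp only [ramp_eq_one_sub_clip hγ, Finset.sum_sub_distrib, Finset.sum_const,
        Finset.card_univ, Fintype.card_fin, nsmul_eq_mul, mul_one]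
      rw [sub_div, div_self hm0.ne']
    have h6 : (∑ i, clip γ (margin (reluNet V U (S i).1) (S i).2)) / m
        ≤ 1 - expectedLoss D 0 (reluNet V U) + 22500 * l * W₀ / m := by
      rw [div_le_iff₀ hm0, add_mul, div_mul_cancel₀ _ hm0.ne']
      linarith
    have h7 : 22500 * l * (Real.sqrt c * η * α * (η * β * P + Q) / (γ * m))
        = 22500 * l * W₀ / m := by
      rw [hW₀, ← div_div]; ring
    rw [h7, h5]
    linarith
  · have hsm : 0 < Real.sqrt m := Real.sqrt_pos.2 hm0
    have h1 : P = Real.sqrt m * Real.sqrt ((1 / m : ℝ) * ∑ i, euclNorm (S i).1 ^ 2) := by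
      rw [← Real.sqrt_mul hm0.le, ← mul_assoc, mul_one_div_cancel hm0.ne', one_mul]
      rfl
    set R := Real.sqrt ((1 / m : ℝ) * ∑ i, euclNorm (S i).1 ^ 2) with hR
    have h2 : Q ≤ specNorm U₀ * P := rootSumSq_mulVec_le U₀ _
    have hsm2 : Real.sqrt m * Real.sqrt m = m := Real.mul_self_sqrt hm0.le
    gcongr _ + _ * ?_
    calc Real.sqrt c * η * α * (η * β * P + Q) / (γ * m)
        ≤ Real.sqrt c * η * α * (η * β * P + specNorm U₀ * P) / (γ * m) := by gcongr
      _ = Real.sqrt c * η * α * (η * β + specNorm U₀) * R / (γ * Real.sqrt m) := by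
          rw [h1]
          nth_rewrite 3 [← hsm2]
          field_simp
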